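/- A permutation $\pi$ of $[n]=\{1,\dots,n\}$ is written in \emph{standard cycle form} $\pi=c_1c_2\cdots c_m$: fixed points count as cycles, each cycle starts with its smallest element, and the cycles are ordered decreasingly by their smallest elements. Then $\pi$ \emph{cyclically avoids} a pattern such as 1--3--2 if the word obtained from the standard cycle form by removing the parentheses has no (not necessarily contiguous) subword in the same relative order as the pattern. Dyck paths have up steps $N$ and down steps $S$; the length of a Dyck path is its number of up steps, a peak is an $N$ immediately followed by an $S$, and an excursion is a subpath between two consecutive visits to the $x$-axis. Define partial operators from objects of size $n$ to objects of size $n+1$. \begin{itemize} \item For a Dyck path $p=e_1\cdots e_k$ with excursions $e_1,\dots,e_k$: $r_0p=p\,NS$, and $r_ip=e_1\cdots e_{i-1}\,N\,e_i\cdots e_k\,S$ for $1\le i\le k$. \item For $\pi=c_1\cdots c_m$ a permutation of $[n]$, let $c_k$ be the first cycle of size at least $2$ (and $k=m$ if there is none): $\rho_0\pi=(n+1)\pi$, and for $1\le i\le k$ the permutation $\rho_i\pi$ arises by inserting $n+1$ in $c_i$ immediately after its first element. \item For $\pi=c_1\cdots c_m$ a permutation of $[n]$, let $i_1<\dots<i_k$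 be the indices of the cycles whose smallest element is greater than all elements in all cycles to the right: $\rho'_0\pi=(n+1)\pi$, and for $1\le i\le k$ the permutation $\rho'_i\pi$ arises by inserting $n+1$ last in the cycle $c_{i_{k+1-i}}$. \end{itemize} \textbf{Theorem.} (a) For every $n\ge 0$, the objects that can be obtained from the empty object by $n$ successive applications of the operators $r_i$ (respectively $\rho_i$, $\rho'_i$) are exactly the Dyck paths of length $n$ (respectively the permutations of $[n]$ that cyclically avoid 1--2--3, and those that cyclically avoid 1--3--2). (b) For all $n,k\ge 0$, the operators define bijections between the Dyck paths of length $n$ with $k$ peaks, the permutations of $[n]$ with $k$ cycles that cyclically avoid 1--2--3, and the permutations of $[n]$ with $k$ cycles that cyclically avoid 1--3--2: each of these objects is generated by exactly one sequence of indices $(i_1,\dots,i_n)$, and the bijections match the objects generated by the same sequence. (c) For all $n,k\ge 1$, the following numbers are equal: the number of permutations of $[n]$ with $k$ cycles that cyclically avoid 1--3--2; the number of permutations of $[n]$ with $k$ cycles that cyclically avoid 1--2--3; the number of Dyck paths of length $n$ with $k$ peaks; the number of permutations of $[n]$ that avoid 1--3--2 in one-line notation and have exactly $k-1$ descents; and the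 Narayana number \[\frac1k\binom{n-1}{k-1}\binom{n}{k-1}.\] -/

import Mathlib

/-! Permutations of `[n] = {1, …, n}` are modelled by `Equiv.Perm (Fin n)`, the element `i : Fin n`
standing for `i + 1`; only the linear order of the letters is ever used. -/

namespace CyclicPattern

section Words

variable {α : Type*} [LinearOrder α]

/-- The unrestricted (fully dashed) pattern `σ`, given in one-line form by an injective word of
length `k`, occurs in the word `w`: there are positions `i₁ < ⋯ < i_k` such that the subword of
`w` at these positions is in the same relative order as `σ`. -/
def Occurs {k : ℕ} (σ : Fin k → ℕ) (w : List α) : Prop :=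
  ∃ f : Fin k ↪o Fin w.length, ∀ a b : Fin k, w.get (f a) < w.get (f b) ↔ σ a < σ b

/-- The number of descents (positions whose letter is greater than the next letter) of a word. -/
def descents (w : List α) : ℕ :=
  (w.zip w.tail).countP fun x => x.2 < x.1

/-- The cycles of a list of cycles, in the given order, whose smallest element
(equivalently, all of whose elements) is greater than all elements in all cycles to the right. -/
def dominatingCycles : List (List α) → List (List α)
  | [] => []
  | c :: cs =>
    if ∀ y ∈ c, ∀ x ∈ cs.flatten, x < y then c :: dominatingCycles cs else dominatingCycles cs

end Words

section Permutations

variable {n : ℕ}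

/-- The cycle of `π` through `m`, written as the word `m, π m, π² m, …`, each element once. -/
def cycleWord (π : Equiv.Perm (Fin n)) (m : Fin n) : List (Fin n) :=
  List.iterate π m (Finset.univ.filter fun j => π.SameCycle m j).card

/-- The minimal elements of the cycles of `π` (fixed points are cycles), in decreasing order. -/
def cycleMinima (π : Equiv.Perm (Fin n)) : List (Fin n) :=
  (List.finRange n).reverse.filter fun m => ∀ j, π.SameCycle m j → m ≤ j

/-- The standard cycle form: each cycle starts with its smallest element, and the cycles are
ordered decreasingly with respect to their minimal elements. -/
def cycleForm (π : Equiv.Perm (Fin n)) : List (List (Fin n)) :=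
  (cycleMinima π).map (cycleWord π)

/-- The number of cycles, fixed points included. -/
def numCycles (π : Equiv.Perm (Fin n)) : ℕ :=
  (cycleForm π).length

/-- The unrestricted pattern `σ` does not occur cyclically in `π`, i.e. it does not occur in the
word obtained from the standard cycle form of `π` by removing the parentheses. -/
def CyclicallyAvoids {k : ℕ} (σ : Fin k → ℕ) (π : Equiv.Perm (Fin n)) : Prop :=
  ¬ Occurs σ (cycleForm π).flatten

/-- The permutation of `[n + 1]` obtained from `π` by adding the 1-cycle `(n + 1)`. -/
def addFixed (π : Equiv.Perm (Fin n)) : Equiv.Perm (Fin (n + 1)) :=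
  (finSuccEquivLast (n := n)).symm.permCongr (Equiv.optionCongr π)

/-- The permutation of `[n + 1]` obtained from `π` by inserting `n + 1` immediately after `a` in
the cycle of `a`: it sends `a` to `n + 1` and `n + 1` to `π a`, and agrees with `π` elsewhere. -/
def insertAfter (π : Equiv.Perm (Fin n)) (a : Fin n) : Equiv.Perm (Fin (n + 1)) :=
  addFixed π * Equiv.swap a.castSucc (Fin.last n)

/-- The operators `ρ_i` for the pattern 1–2–3. `ρ_0` adds the cycle `(n + 1)`. If
`π = c₁ ⋯ c_m` and `c_k` is the first cycle of size at least two (with no bound other than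
`i ≤ m` if all cycles have size one), then `ρ_i`, `1 ≤ i ≤ k`, inserts `n + 1`
immediately after the first element of `c_i`. For all other `i`, `ρ_i π` is undefined. -/
def rho (i : ℕ) (π : Equiv.Perm (Fin n)) : Option (Equiv.Perm (Fin (n + 1))) :=
  match i with
  | 0 => some (addFixed π)
  | j + 1 =>
    if j ≤ (cycleForm π).findIdx (fun c => 2 ≤ c.length) then
      ((cycleForm π)[j]?.bind List.head?).map (insertAfter π)
    else none

/-- The operators `ρ'_i` for the pattern 1–3–2. `ρ'_0` adds the cycle `(n + 1)`. If `d₁, …, d_k`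
are, from left to right, the cycles whose smallest element is greater than all elements in all
cycles to the right, then `ρ'_i`, `1 ≤ i ≤ k`, inserts `n + 1` last in the cycle
`d_{k + 1 - i}`. For all other `i`, `ρ'_i π` is undefined. -/
def rho' (i : ℕ) (π : Equiv.Perm (Fin n)) : Option (Equiv.Perm (Fin (n + 1))) :=
  match i with
  | 0 => some (addFixed π)
  | j + 1 =>
    ((dominatingCycles (cycleForm π)).reverse[j]?.bind List.getLast?).map (insertAfter π)

end Permutations

section DyckPaths

/-- The number of peaks: up steps immediately followed by a down step. -/
def peaks (p : DyckWord) : ℕ :=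
  (p.toList.zip p.toList.tail).count (DyckStep.U, DyckStep.D)

/-- The decomposition of a Dyck path into excursions, the subpaths between consecutive visits
to the axis. -/
def excursions (p : DyckWord) : List DyckWord :=
  if _h : p = 0 then [] else p.insidePart.nest :: excursions p.outsidePart
termination_by p.semilength
decreasing_by exact DyckWord.semilength_outsidePart_lt _h

/-- The operators `r_i` on Dyck paths, `N` and `S` being up and down steps. `r_0 p = p N S`. If
`p = e₁ ⋯ e_k` is the decomposition into excursions, then
`r_i p = e₁ ⋯ e_{i - 1} N e_i ⋯ e_k S` for `1 ≤ i ≤ k`. For all other `i`,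
`r_i p` is undefined. -/
def r (i : ℕ) (p : DyckWord) : Option DyckWord :=
  match i with
  | 0 => some (p + DyckWord.nest 0)
  | j + 1 =>
    if j < (excursions p).length then
      some (((excursions p).take j).sum + ((excursions p).drop j).sum.nest)
    else none

end DyckPaths

/-- The Dyck path obtained by applying `r_{i₁}`, …, `r_{i_n}` in this order to the empty path,
if all these applications are defined. -/
def rSeq : (n : ℕ) → (Fin n → ℕ) → Option DyckWord
  | 0, _ => some 0
  | n + 1, s => (rSeq n (Fin.init s)).bind (r (s (Fin.last n)))

/-- The permutation obtained by applying `ρ_{i₁}`, …, `ρ_{i_n}` in this order to the empty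
permutation, if all these applications are defined. -/
def rhoSeq : (n : ℕ) → (Fin n → ℕ) → Option (Equiv.Perm (Fin n))
  | 0, _ => some 1
  | n + 1, s => (rhoSeq n (Fin.init s)).bind (rho (s (Fin.last n)))

/-- The permutation obtained by applying `ρ'_{i₁}`, …, `ρ'_{i_n}` in this order to the empty
permutation, if all these applications are defined. -/
def rhoSeq' : (n : ℕ) → (Fin n → ℕ) → Option (Equiv.Perm (Fin n))
  | 0, _ => some 1
  | n + 1, s => (rhoSeq' n (Fin.init s)).bind (rho' (s (Fin.last n)))

/-- Dyck paths of length (number of up steps) `n` with `k` peaks. -/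
abbrev DyckPeaks (n k : ℕ) : Type :=
  {p : DyckWord // p.semilength = n ∧ peaks p = k}

/-- Permutations of `[n]` with `k` cycles that cyclically avoid `σ`. -/
abbrev CycAv {l : ℕ} (σ : Fin l → ℕ) (n k : ℕ) : Type :=
  {π : Equiv.Perm (Fin n) // CyclicallyAvoids σ π ∧ numCycles π = k}

/-- Permutations of `[n]` that avoid `σ` in one-line form and have `d` descents. -/
abbrev AvDes {l : ℕ} (σ : Fin l → ℕ) (n d : ℕ) : Type :=
  {π : Equiv.Perm (Fin n) // ¬ Occurs σ (List.ofFn π) ∧ descents (List.ofFn π) = d}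

end CyclicPattern

/-! All three families carry the same labelled tree. Let the label of an object be its largest
admissible index: the number of excursions; the position of the first cycle of size at least two
(the number of cycles if there is none); the number of dominating cycles. In each family index 0
turns label `l` into `l + 1` and adds one peak or cycle, while an index `1 ≤ i ≤ l` produces label
`i` and keeps that statistic. Hence admissibility of a sequence of indices depends on labels alone
(`codeState`), and `k` counts its zeros.

What remains is that every object of size `n + 1` has exactly one parent and index. For a Dyck path,
look at the last excursion. For a permutation, remove the largest letter: it can only play the 3 of
a pattern, so inserting it after `a` in an avoiding word is harmless exactly when the prefix ending
in `a` contains no increasing pair (1–2–3), or when no letter of that prefix is smaller than a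
letter after it (1–3–2). In standard cycle form the first condition says that `a` heads its cycle
and only fixed points precede that cycle; the second says that `a` ends its cycle and that this
cycle dominates. These are the rules for `rho` and `rho'`. The three trees are `isCatalanTree_r`,
`isCatalanTree_rho` and `isCatalanTree_rho'`; `IsCatalanTree.exists_equiv` matches each with codes.

Codes counted by length, label and number of zeros satisfy a recurrence with a ballot-type solution
(`card_codeEq_mul`); summing over labels gives the Narayana number (`card_code`). For the descent
count, erasing parentheses is a bijection on permutations that turns cyclic avoidance into one-line
avoidance, and on nonempty 1–3–2 avoiders there is one descent fewer than cycles
(`descents_add_one_eq_numCycles`). -/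

namespace CyclicPattern

/-! ### The Catalan generating tree and its codes. -/

section GeneratingTrees

/-- The label (number of admissible nonzero indices) and the number of zeros reached by a sequence
of indices in the Catalan tree: in a node with label `l` the indices `0, …, l` are admissible,
index `0` leads to label `l + 1` and index `i ≥ 1` leads to label `i`. -/
def codeState : (n : ℕ) → (Fin n → ℕ) → Option (ℕ × ℕ)
  | 0, _ => some (0, 0)
  | n + 1, s => (codeState n (Fin.init s)).bind fun x =>
      if s (Fin.last n) = 0 then some (x.1 + 1, x.2 + 1)
      else if s (Fin.last n) ≤ x.1 then some (s (Fin.last n), x.2) else none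

/-- The operators `op` generate the objects satisfying `Good` along the Catalan tree, each object
exactly once; `seq` is the object generated by a sequence of indices. -/
structure IsCatalanTree {X : ℕ → Type} (seq : ∀ n, (Fin n → ℕ) → Option (X n))
    (op : ∀ n, ℕ → X n → Option (X (n + 1))) (lab st : ∀ n, X n → ℕ)
    (Good : ∀ n, X n → Prop) : Prop where
  root : ∃ x, (∀ s, seq 0 s = some x) ∧ Good 0 x ∧ lab 0 x = 0 ∧ st 0 x = 0 ∧ ∀ y, Good 0 y → y = x
  seq_succ : ∀ n s, seq (n + 1) s = (seq n (Fin.init s)).bind (op n (s (Fin.last n)))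
  isSome_op : ∀ n i x, Good n x → ((op n i x).isSome ↔ i ≤ lab n x)
  good_op : ∀ n i x y, Good n x → op n i x = some y → Good (n + 1) y
  lab_op : ∀ n i x y, Good n x → op n i x = some y →
    lab (n + 1) y = if i = 0 then lab n x + 1 else i
  st_op : ∀ n i x y, Good n x → op n i x = some y →
    st (n + 1) y = if i = 0 then st n x + 1 else st n x
  exists_op : ∀ n y, Good (n + 1) y → ∃ i x, Good n x ∧ op n i x = some y
  op_inj : ∀ n i j x x' y, Good n x → Good n x' → op n i x = some y → op n j x' = some y →
    i = j ∧ x = x'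

namespace IsCatalanTree

variable {X : ℕ → Type} {seq : ∀ n, (Fin n → ℕ) → Option (X n)}
  {op : ∀ n, ℕ → X n → Option (X (n + 1))} {lab st : ∀ n, X n → ℕ} {Good : ∀ n, X n → Prop}

theorem good_of_seq (h : IsCatalanTree seq op lab st Good) :
    ∀ n s x, seq n s = some x → Good n x := by
  intro n
  induction n with
  | zero =>
    intro s x hx
    obtain ⟨x₀, h0, hg, -⟩ := h.root
    rw [h0] at hx
    cases hx
    exact hg
  | succ n ih =>
    intro s x hx
    rw [h.seq_succ, Option.bind_eq_some_iff] at hx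
    obtain ⟨y, hy, hyx⟩ := hx
    exact h.good_op _ _ _ _ (ih _ _ hy) hyx

/-- The rules for admissibility, label and statistic mention nothing but labels and indices, so
induction along the sequence removes all dependence on the family. This makes codes a common model.
-/
theorem map_seq (h : IsCatalanTree seq op lab st Good) :
    ∀ n s, (seq n s).map (fun x => (lab n x, st n x)) = codeState n s := by
  intro n
  induction n with
  | zero =>
    intro s
    obtain ⟨x₀, h0, hg, hl, hs, -⟩ := h.root
    simp [h0, codeState, hl, hs]
  | succ n ih =>
    intro s
    rw [h.seq_succ, codeState, ← ih]
    cases hx : seq n (Fin.init s) with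
    | none => simp
    | some x =>
      have hg := h.good_of_seq _ _ _ hx
      simp only [Option.bind_some, Option.map_some]
      cases hy : op n (s (Fin.last n)) x with
      | none =>
        have h1 := h.isSome_op n (s (Fin.last n)) x hg
        simp only [hy, Option.isSome_none, Bool.false_eq_true, false_iff, not_le] at h1
        rw [if_neg (by omega), if_neg (by omega)]
        rfl
      | some y =>
        have h1 := h.isSome_op n (s (Fin.last n)) x hg
        simp only [hy, Option.isSome_some, true_iff] at h1
        simp only [Option.map_some, h.lab_op _ _ _ _ hg hy, h.st_op _ _ _ _ hg hy]
        split_ifs <;> rfl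

theorem existsUnique_seq (h : IsCatalanTree seq op lab st Good) :
    ∀ n x, Good n x → ∃! s, seq n s = some x := by
  intro n
  induction n with
  | zero =>
    intro x hx
    obtain ⟨x₀, h0, hg, hl, hs, hu⟩ := h.root
    exact ⟨Fin.elim0, (h0 _).trans (by rw [hu x hx]), fun s _ => funext fun i => i.elim0⟩
  | succ n ih =>
    intro y hy
    obtain ⟨i, x, hx, hxy⟩ := h.exists_op n y hy
    obtain ⟨s, hs, hsu⟩ := ih x hx
    refine ⟨Fin.snoc s i, ?_, ?_⟩
    · simp only [h.seq_succ, Fin.init_snoc, hs, Fin.snoc_last, Option.bind_some, hxy]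
    · intro t ht
      simp only [h.seq_succ, Option.bind_eq_some_iff] at ht
      obtain ⟨x', hx', ht⟩ := ht
      obtain ⟨h1, rfl⟩ := h.op_inj n _ _ _ _ _ hx (h.good_of_seq _ _ _ hx') hxy ht
      rw [h1, ← hsu _ hx', Fin.snoc_init_self]

theorem exists_seq_iff (h : IsCatalanTree seq op lab st Good) (n : ℕ) (x : X n) :
    (∃ s, seq n s = some x) ↔ Good n x :=
  ⟨fun ⟨s, hs⟩ => h.good_of_seq n s x hs, fun hx => (h.existsUnique_seq n x hx).exists⟩

/-- The objects with statistic `k` correspond to the sequences of indices with `k` zeros. -/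
theorem exists_equiv (h : IsCatalanTree seq op lab st Good) (n k : ℕ) :
    ∃ e : {x : X n // Good n x ∧ st n x = k} ≃
        {s : Fin n → ℕ // ∃ l, codeState n s = some (l, k)},
      ∀ x s, seq n s = some x.1 ↔ (e x).1 = s := by
  choose f hf hfu using fun x : {x : X n // Good n x ∧ st n x = k} =>
    h.existsUnique_seq n x.1 x.2.1
  have hcode : ∀ x, ∃ l, codeState n (f x) = some (l, k) := fun x => by
    refine ⟨lab n x.1, ?_⟩
    rw [← h.map_seq, hf, Option.map_some, x.2.2]
  refine ⟨Equiv.ofBijective (fun x => ⟨f x, hcode x⟩) ⟨?_, ?_⟩, ?_⟩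
  · intro x y hxy
    have h1 : f x = f y := congrArg Subtype.val hxy
    have h2 := hf x
    rw [h1, hf y] at h2
    exact Subtype.ext (Option.some.inj h2).symm
  -- By `map_seq`, an admissible code generates an object, and uniqueness of its sequence returns
  -- the code.
  · rintro ⟨s, l, hl⟩
    rw [← h.map_seq, Option.map_eq_some_iff] at hl
    obtain ⟨x, hx, hl⟩ := hl
    refine ⟨⟨x, h.good_of_seq _ _ _ hx, congrArg Prod.snd hl⟩, Subtype.ext ?_⟩
    exact (hfu _ _ hx).symm
  · intro x s
    exact ⟨fun hs => (hfu x s hs).symm, fun hs => hs ▸ hf x⟩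

end IsCatalanTree

end GeneratingTrees

/-! ### Counting codes: the Narayana numbers. -/

section Enumeration

/-- Sequences of indices of length `n` leading to label `l` with `k` zeros. -/
abbrev CodeEq (n l k : ℕ) : Type := {s : Fin n → ℕ // codeState n s = some (l, k)}

/-- Sequences of indices of length `n` leading to a label at least `j` with `k` zeros. -/
abbrev CodeGe (n j k : ℕ) : Type := {s : Fin n → ℕ // ∃ l, j ≤ l ∧ codeState n s = some (l, k)}

/-- Only index 0 raises the label, and it adds a zero at the same time; both rules lead to a
positive label. -/
theorem codeState_bounds : ∀ n (s : Fin n → ℕ) l k, codeState n s = some (l, k) →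
    l ≤ k ∧ k ≤ n ∧ (0 < n → 0 < l) := by
  intro n
  induction n with
  | zero => simp [codeState]
  | succ n ih =>
    intro s l k h
    rw [codeState, Option.bind_eq_some_iff] at h
    obtain ⟨⟨l', k'⟩, h1, h2⟩ := h
    have := ih _ _ _ h1
    split_ifs at h2 <;> simp at h2 <;> omega

/-- There are finitely many admissible sequences of indices. -/
theorem finite_codes : ∀ n, {s : Fin n → ℕ | (codeState n s).isSome}.Finite := by
  intro n
  -- A nonzero index is at most the preceding label, hence at most the number of earlier steps.
  refine (Set.finite_Iic (fun _ : Fin n => n)).subset ?_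
  induction n with
  | zero => exact fun s _ i => i.elim0
  | succ n ih =>
    intro s hs i
    obtain ⟨x, hx⟩ := Option.isSome_iff_exists.1 hs
    rw [codeState, Option.bind_eq_some_iff] at hx
    obtain ⟨⟨l, k⟩, h1, h2⟩ := hx
    have hb := codeState_bounds _ _ _ _ h1
    induction i using Fin.lastCases with
    | last =>
      change s (Fin.last n) ≤ n + 1
      split_ifs at h2 <;> simp at h2 <;> omega
    | cast i =>
      have : s i.castSucc ≤ n := ih (a := Fin.init s) (by simp [h1]) i
      change s i.castSucc ≤ n + 1
      omega

instance (n l k : ℕ) : Finite (CodeEq n l k) :=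
  ((finite_codes n).subset fun s (hs : codeState n s = some (l, k)) => by simp [hs]).to_subtype

instance (n j k : ℕ) : Finite (CodeGe n j k) :=
  ((finite_codes n).subset fun s (hs : ∃ l, j ≤ l ∧ codeState n s = some (l, k)) => by
    obtain ⟨l, -, hs⟩ := hs
    simp [hs]).to_subtype

theorem card_codeGe_eq_add (n j k : ℕ) :
    Nat.card (CodeGe n j k) = Nat.card (CodeEq n j k) + Nat.card (CodeGe n (j + 1) k) := by
  have := Set.ncard_union_eq (s := {s : Fin n → ℕ | codeState n s = some (j, k)})
    (t := {s : Fin n → ℕ | ∃ l, j + 1 ≤ l ∧ codeState n s = some (l, k)}) (by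
      rw [Set.disjoint_left]
      rintro s (hs : _ = _) ⟨l, hl, hs'⟩
      rw [hs] at hs'
      simp at hs'
      omega) (inferInstanceAs (Finite (CodeEq n j k)))
      (inferInstanceAs (Finite (CodeGe n (j + 1) k)))
  simp only [← Nat.card_coe_set_eq] at this
  refine Eq.trans (congrArg (fun S : Set (Fin n → ℕ) => Nat.card S) ?_) this
  ext s
  constructor
  · rintro ⟨l, hl, hs⟩
    rcases hl.eq_or_lt with rfl | hl
    · exact Or.inl hs
    · exact Or.inr ⟨l, hl, hs⟩
  · rintro (hs | ⟨l, hl, hs⟩)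
    · exact ⟨j, le_rfl, hs⟩
    · exact ⟨l, by omega, hs⟩

theorem card_codeGe_of_lt {n j k : ℕ} (h : k < j) : Nat.card (CodeGe n j k) = 0 := by
  rw [Nat.card_eq_zero]
  left
  refine ⟨fun ⟨s, l, hl, hs⟩ => ?_⟩
  have := codeState_bounds _ _ _ _ hs
  omega

theorem codeState_snoc (n : ℕ) (s : Fin n → ℕ) (i : ℕ) :
    codeState (n + 1) (Fin.snoc s i) = (codeState n s).bind fun x =>
      if i = 0 then some (x.1 + 1, x.2 + 1) else if i ≤ x.1 then some (i, x.2) else none := by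
  simp [codeState]

/-- Remove the last index: it is 0, coming from label `j`, or it is `j + 1`, coming from any label
at least `j + 1`. -/
theorem card_codeEq_succ (n j k : ℕ) :
    Nat.card (CodeEq (n + 1) (j + 1) (k + 1)) =
      Nat.card (CodeEq n j k) + Nat.card (CodeGe n (j + 1) (k + 1)) := by
  rw [← Nat.card_sum]
  refine (Nat.card_congr (Equiv.ofBijective (Sum.elim
    (fun s => ⟨Fin.snoc s.1 0, by simp [codeState_snoc, s.2]⟩)
    (fun s => ⟨Fin.snoc s.1 (j + 1), by
      obtain ⟨s, l, hl, hs⟩ := s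
      have : j < l := hl
      simp [codeState_snoc, hs, this]⟩)) ⟨?_, ?_⟩)).symm
  · rintro (⟨s, hs⟩ | ⟨s, hs⟩) (⟨t, ht⟩ | ⟨t, ht⟩) h <;>
      simp [Fin.snoc_inj] at h
    · simpa using h
    · simpa using h
  · rintro ⟨s, hs⟩
    have hs' := hs
    rw [codeState, Option.bind_eq_some_iff] at hs'
    obtain ⟨⟨l, m⟩, h1, h2⟩ := hs'
    split_ifs at h2 with h3 h4 <;> simp at h2
    · refine ⟨Sum.inl ⟨Fin.init s, by rw [h1, h2.1, h2.2]⟩, Subtype.ext ?_⟩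
      simp [← h3, Fin.snoc_init_self]
    · refine ⟨Sum.inr ⟨Fin.init s, l, by omega, by rw [h1, h2.2]⟩, Subtype.ext ?_⟩
      simp [← h2.1, Fin.snoc_init_self]

theorem card_codeEq_zero_label {n k : ℕ} (h : 0 < n) : Nat.card (CodeEq n 0 k) = 0 := by
  rw [Nat.card_eq_zero]
  left
  refine ⟨fun ⟨s, hs⟩ => ?_⟩
  have := codeState_bounds _ _ _ _ hs
  omega

theorem card_codeGe_of_lt_zeros {n j k : ℕ} (h : n < k) : Nat.card (CodeGe n j k) = 0 := by
  rw [Nat.card_eq_zero]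
  left
  refine ⟨fun ⟨s, l, hl, hs⟩ => ?_⟩
  have := codeState_bounds _ _ _ _ hs
  omega

/-- Here `k = j + a` is the number of zeros and `b` the number of nonzero indices. For fixed `k` the
count for labels at least `j` is a tail sum of the exact counts; it starts at `j = k`, the largest
possible label, and Pascal's rule telescopes it. -/
theorem card_codeGe_mul_of_codeEq {n : ℕ}
    (h : ∀ j a b, j + a + b = n → (Nat.card (CodeEq n j (j + a)) : ℚ) * n =
      j * n.choose b * (a + b - 1).choose a) :
    ∀ a j b, j + a + b = n → (Nat.card (CodeGe n j (j + a)) : ℚ) * n =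
      n.choose b * (j * (a + b).choose b + (a + b).choose (b + 1)) := by
  intro a
  induction a with
  | zero =>
    intro j b hn
    have := h j 0 b hn
    rw [card_codeGe_eq_add, card_codeGe_of_lt (j := j + 1) (by omega)]
    push_cast
    rw [add_zero, this]
    simp
    ring
  | succ a ih =>
    intro j b hn
    have h1 := h j (a + 1) b hn
    have h2 := ih (j + 1) b (by omega)
    rw [show j + 1 + a = j + (a + 1) by ring] at h2
    rw [card_codeGe_eq_add]
    push_cast at h2 ⊢
    rw [add_mul, h1, h2]
    cases b with
    | zero => simp; ring
    | succ b =>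
      have e1 : (a + 1 + (b + 1) - 1).choose (a + 1) = (a + (b + 1)).choose b := by
        rw [show a + 1 + (b + 1) - 1 = a + 1 + b by omega, show a + (b + 1) = a + 1 + b by omega,
          Nat.choose_symm_add]
      have e2 : (a + 1 + (b + 1)).choose (b + 1) =
          (a + (b + 1)).choose b + (a + (b + 1)).choose (b + 1) := by
        rw [show a + 1 + (b + 1) = (a + (b + 1)) + 1 by omega, Nat.choose_succ_succ']
      have e3 : (a + 1 + (b + 1)).choose (b + 1 + 1) =
          (a + (b + 1)).choose (b + 1) + (a + (b + 1)).choose (b + 1 + 1) := by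
        rw [show a + 1 + (b + 1) = (a + (b + 1)) + 1 by omega, Nat.choose_succ_succ']
      rw [e1, e2, e3]
      push_cast
      ring

/-- Ballot-type formula, with the denominator `n` cleared. The recurrence of `card_codeEq_succ`
preserves it once the tail sum is in closed form. Truncated subtraction gives the value 1 to the
last binomial when `a = b = 0`, as it should. -/
theorem card_codeEq_mul : ∀ n j a b, j + a + b = n →
    (Nat.card (CodeEq n j (j + a)) : ℚ) * n = j * n.choose b * (a + b - 1).choose a := by
  intro n
  induction n with
  | zero =>
    intro j a b h
    obtain rfl : j = 0 := by omega
    simp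
  | succ n ih =>
    intro j a b h
    rcases j with _ | j
    · rw [card_codeEq_zero_label (by omega)]
      simp
    have hE := ih j a b (by omega)
    rw [show j + 1 + a = j + a + 1 by ring, card_codeEq_succ]
    rcases b with _ | c
    · rw [card_codeGe_of_lt_zeros (by omega)]
      -- Multiplied by `n = 0` the induction hypothesis says nothing, so the empty code is counted
      -- directly.
      rcases Nat.eq_zero_or_pos n with rfl | hn
      · obtain ⟨rfl, rfl⟩ : j = 0 ∧ a = 0 := by omega
        have : Nat.card (CodeEq 0 0 0) = 1 := by
          rw [Nat.card_eq_one_iff_unique]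
          exact ⟨inferInstance, ⟨⟨Fin.elim0, rfl⟩⟩⟩
        simp only [Nat.add_zero, this]
        simp
      · have hn' : (n : ℚ) ≠ 0 := by positivity
        rcases a with _ | a
        · obtain rfl : j = n := by omega
          have : (Nat.card (CodeEq j j (j + 0)) : ℚ) = 1 := by
            refine mul_right_cancel₀ hn' (hE.trans ?_)
            simp
          push_cast
          rw [this]
          simp
        · have : (Nat.card (CodeEq n j (j + (a + 1))) : ℚ) = 0 := by
            refine mul_right_cancel₀ hn' (hE.trans ?_)
            simp
          push_cast
          rw [this]
          simp
    · have hM := card_codeGe_mul_of_codeEq ih a (j + 1) c (by omega)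
      rw [show j + 1 + a = j + a + 1 by ring] at hM
      have e0 : (a + (c + 1) - 1).choose a = (a + c).choose c := by
        rw [show a + (c + 1) - 1 = a + c by omega, Nat.choose_symm_add]
      have e1 : (n.choose (c + 1) : ℚ) * (c + 1) = n.choose c * (j + a + 1) := by
        have := Nat.choose_succ_right_eq n c
        rw [show n - c = j + a + 1 by omega] at this
        exact_mod_cast this
      have e2 : ((n + 1 : ℚ)) * n.choose c = (n + 1).choose (c + 1) * (c + 1) := by
        exact_mod_cast Nat.add_one_mul_choose_eq n c
      have e3 : ((a + c).choose (c + 1) : ℚ) * (c + 1) = (a + c).choose c * a := by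
        have := Nat.choose_succ_right_eq (a + c) c
        rw [show a + c - c = a by omega] at this
        exact_mod_cast this
      have hn : (n : ℚ) = j + a + c + 1 := by
        rw [← show j + 1 + a + (c + 1) - 1 = n by omega]
        push_cast [show j + 1 + a + (c + 1) - 1 = j + a + c + 1 by omega]
        rfl
      rw [e0] at hE ⊢
      have hne : (n : ℚ) * (c + 1) ≠ 0 := by
        rw [hn]
        positivity
      refine mul_right_cancel₀ hne ?_
      push_cast at hM ⊢
      generalize (Nat.card (CodeEq n j (j + a)) : ℚ) = x at *
      generalize (Nat.card (CodeGe n (j + 1) (j + a + 1)) : ℚ) = y at *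
      generalize (n.choose (c + 1) : ℚ) = p at *
      generalize ((n + 1).choose (c + 1) : ℚ) = q at *
      generalize (n.choose c : ℚ) = u at *
      generalize ((a + c).choose c : ℚ) = v at *
      generalize ((a + c).choose (c + 1) : ℚ) = w at *
      rw [show (x + y) * (n + 1) * (n * (c + 1)) = (x * n + y * n) * (n + 1) * (c + 1) by ring,
        hE, hM]
      -- Only the absorption identities for binomial coefficients and `n = j + a + c + 1` are
      -- needed.
      linear_combination (n + 1) * j * v * e1 + n * (j + 1) * v * e2 +
        (n + 1) * u * e3 - (n + 1) * (j + 1) * u * v * hn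

/-- The number of admissible sequences of indices with `k` zeros is a Narayana number. -/
theorem card_code (n k : ℕ) (hn : 1 ≤ n) (hk : 1 ≤ k) :
    (Nat.card {s : Fin n → ℕ // ∃ l, codeState n s = some (l, k)} : ℚ) =
      1 / (k : ℚ) * ((n - 1).choose (k - 1) : ℚ) * (n.choose (k - 1) : ℚ) := by
  have h0 : Nat.card {s : Fin n → ℕ // ∃ l, codeState n s = some (l, k)} =
      Nat.card (CodeGe n 1 k) := by
    refine Nat.card_congr (Equiv.subtypeEquivRight fun s => exists_congr fun l => ?_)
    exact ⟨fun h => ⟨(codeState_bounds _ _ _ _ h).2.2 hn, h⟩, fun h => h.2⟩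
  rw [h0]
  obtain ⟨a, rfl⟩ : ∃ a, k = a + 1 := ⟨k - 1, by omega⟩
  obtain ⟨m, rfl⟩ : ∃ m, n = m + 1 := ⟨n - 1, by omega⟩
  rcases Nat.lt_or_ge m a with h | h
  · rw [card_codeGe_of_lt_zeros (by omega)]
    simp [Nat.choose_eq_zero_of_lt h]
  obtain ⟨b, rfl⟩ := Nat.exists_eq_add_of_le h
  -- For `n ≥ 1` all labels are at least 1, so the tail from `j = 1` is everything. It yields `C(n,
  -- k) C(n, k - 1) / n`, and `e3` converts this to the stated form.
  have hM := card_codeGe_mul_of_codeEq (card_codeEq_mul (a + b + 1)) a 1 b (by omega)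
  have e1 : (a + b + 1).choose b = (a + b + 1).choose (a + 1) := by
    rw [show a + b + 1 = (a + 1) + b by ring, Nat.choose_symm_add]
  have e2 : (a + b).choose b + (a + b).choose (b + 1) = (a + b + 1).choose a := by
    rw [← Nat.choose_succ_succ', show a + b + 1 = a + (b + 1) by ring, Nat.choose_symm_add]
  have e3 : ((a + b + 1 : ℚ)) * (a + b).choose a = (a + b + 1).choose (a + 1) * (a + 1) := by
    exact_mod_cast Nat.add_one_mul_choose_eq (a + b) a
  have e2' : ((a + b).choose b : ℚ) + (a + b).choose (b + 1) = (a + b + 1).choose a := by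
    exact_mod_cast e2
  rw [Nat.cast_one, one_mul, e2', e1, add_comm 1 a] at hM
  simp only [Nat.add_sub_cancel]
  push_cast at hM ⊢
  have h1 : (a + b + 1 : ℚ) ≠ 0 := by positivity
  have h2 : (a + 1 : ℚ) ≠ 0 := by positivity
  field_simp
  refine mul_right_cancel₀ h1 ?_
  linear_combination (a + 1 : ℚ) * hM - (a + b + 1).choose a * e3

end Enumeration

/-! ### The standard cycle form under insertion of the largest letter. -/

section CycleForms

variable {n : ℕ}

@[simp] theorem addFixed_castSucc (π : Equiv.Perm (Fin n)) (x : Fin n) :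
    addFixed π x.castSucc = (π x).castSucc := by
  simp [addFixed, Equiv.permCongr_apply]

@[simp] theorem addFixed_last (π : Equiv.Perm (Fin n)) :
    addFixed π (Fin.last n) = Fin.last n := by
  simp [addFixed, Equiv.permCongr_apply]

theorem addFixed_injective : Function.Injective (addFixed (n := n)) := fun π σ h => by
  ext x
  have := congrArg (fun τ => (τ x.castSucc : ℕ)) h
  simpa using this

@[simp] theorem insertAfter_last (π : Equiv.Perm (Fin n)) (a : Fin n) :
    insertAfter π a (Fin.last n) = (π a).castSucc := by
  simp [insertAfter]

theorem insertAfter_castSucc (π : Equiv.Perm (Fin n)) (a x : Fin n) :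
    insertAfter π a x.castSucc = if x = a then Fin.last n else (π x).castSucc := by
  split_ifs with h
  · simp [insertAfter, h]
  · rw [insertAfter, Equiv.Perm.mul_apply, Equiv.swap_apply_of_ne_of_ne (by simpa using h)
      (Fin.castSucc_lt_last x).ne, addFixed_castSucc]

theorem addFixed_ne_insertAfter (π σ : Equiv.Perm (Fin n)) (a : Fin n) :
    addFixed π ≠ insertAfter σ a := fun h => by
  have := congrArg (fun τ => τ (Fin.last n)) h
  simp only [addFixed_last, insertAfter_last] at this
  exact (Fin.castSucc_lt_last _).ne this.symm

theorem insertAfter_inj {π σ : Equiv.Perm (Fin n)} {a b : Fin n}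
    (h : insertAfter π a = insertAfter σ b) : π = σ ∧ a = b := by
  have hab : a = b := by
    by_contra hne
    have := congrArg (fun τ => τ a.castSucc) h
    simp only [insertAfter_castSucc, if_true, if_neg hne] at this
    exact (Fin.castSucc_lt_last _).ne this.symm
  subst hab
  exact ⟨addFixed_injective (mul_right_cancel h), rfl⟩

theorem eq_addFixed_of_last {τ : Equiv.Perm (Fin (n + 1))} (h : τ (Fin.last n) = Fin.last n) :
    ∃ π, τ = addFixed π := by
  refine ⟨Equiv.removeNone (finSuccEquivLast.permCongr τ), ?_⟩
  -- Read on `Option (Fin n)`, `τ` fixes `none`, so `removeNone` loses no information.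
  have h0 : Equiv.optionCongr (Equiv.removeNone (finSuccEquivLast.permCongr τ)) =
      finSuccEquivLast.permCongr τ := by
    ext1 x
    have hnone : finSuccEquivLast.permCongr τ none = none := by
      simp [Equiv.permCongr_apply, h]
    cases x with
    | none => rw [hnone]; rfl
    | some x =>
      rw [Equiv.optionCongr_apply, Option.map_some, Equiv.removeNone_some]
      rw [← Option.ne_none_iff_exists']
      intro h1
      exact absurd (Equiv.injective _ (h1.trans hnone.symm)) (by simp)
  rw [addFixed, h0]
  ext x
  simp [Equiv.permCongr_apply]

/-- Every permutation of `[n + 1]` arises from one of `[n]` by adding the largest letter. -/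
theorem eq_addFixed_or_insertAfter (τ : Equiv.Perm (Fin (n + 1))) :
    (∃ π, τ = addFixed π) ∨ ∃ π a, τ = insertAfter π a := by
  by_cases h : τ (Fin.last n) = Fin.last n
  · exact Or.inl (eq_addFixed_of_last h)
  · right
    have h1 : τ⁻¹ (Fin.last n) ≠ Fin.last n := fun h2 => h (by
      conv_lhs => rw [← h2]
      simp)
    obtain ⟨a, ha⟩ := Fin.exists_castSucc_eq.2 h1
    obtain ⟨π, hπ⟩ := eq_addFixed_of_last (τ := τ * Equiv.swap a.castSucc (Fin.last n))
      (by simp [ha])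
    exact ⟨π, a, by rw [insertAfter, ← hπ, Equiv.mul_swap_mul_self]⟩

/-- The word obtained by adding the largest letter immediately after the letter `a`. -/
def insertLetter (a : Fin n) (w : List (Fin n)) : List (Fin (n + 1)) :=
  w.flatMap fun x => if x = a then [x.castSucc, Fin.last n] else [x.castSucc]

@[simp] theorem insertLetter_nil (a : Fin n) : insertLetter a [] = [] := rfl

theorem insertLetter_cons (a x : Fin n) (w : List (Fin n)) :
    insertLetter a (x :: w) =
      (if x = a then [x.castSucc, Fin.last n] else [x.castSucc]) ++ insertLetter a w := by
  simp [insertLetter]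

theorem insertLetter_append (a : Fin n) (v w : List (Fin n)) :
    insertLetter a (v ++ w) = insertLetter a v ++ insertLetter a w := by
  simp [insertLetter]

theorem insertLetter_of_notMem {a : Fin n} {w : List (Fin n)} (h : a ∉ w) :
    insertLetter a w = w.map Fin.castSucc := by
  induction w with
  | nil => rfl
  | cons x w ih =>
    simp only [List.mem_cons, not_or] at h
    rw [insertLetter_cons, if_neg (Ne.symm h.1), ih h.2]
    rfl

theorem insertLetter_append_cons {a : Fin n} {u v : List (Fin n)} (hu : a ∉ u) (hv : a ∉ v) :
    insertLetter a (u ++ a :: v) =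
      (u ++ [a]).map Fin.castSucc ++ Fin.last n :: v.map Fin.castSucc := by
  rw [insertLetter_append, insertLetter_cons, insertLetter_of_notMem hu, insertLetter_of_notMem hv]
  simp

@[simp] theorem castSucc_mem_insertLetter {a x : Fin n} {w : List (Fin n)} :
    x.castSucc ∈ insertLetter a w ↔ x ∈ w := by
  simp only [insertLetter, List.mem_flatMap]
  constructor
  · rintro ⟨y, hy, h⟩
    split_ifs at h <;> simp [(Fin.castSucc_lt_last x).ne] at h <;> exact h ▸ hy
  · exact fun h => ⟨x, h, by split_ifs <;> simp⟩

@[simp] theorem last_mem_insertLetter {a : Fin n} {w : List (Fin n)} :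
    Fin.last n ∈ insertLetter a w ↔ a ∈ w := by
  simp only [insertLetter, List.mem_flatMap]
  constructor
  · rintro ⟨y, hy, h⟩
    split_ifs at h with h1
    · exact h1 ▸ hy
    · simp [(Fin.castSucc_lt_last y).ne'] at h
  · exact fun h => ⟨a, h, by simp⟩

theorem flatten_map_insertLetter (a : Fin n) (L : List (List (Fin n))) :
    (L.map (insertLetter a)).flatten = insertLetter a L.flatten := by
  induction L with
  | nil => rfl
  | cons c L ih => simp [ih, insertLetter_append]

theorem nodup_insertLetter {a : Fin n} {w : List (Fin n)} (h : w.Nodup) :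
    (insertLetter a w).Nodup := by
  induction w with
  | nil => simp
  | cons x w ih =>
    rw [List.nodup_cons] at h
    rw [insertLetter_cons]
    split_ifs with hx
    · subst hx
      simp [ih h.2, h.1, (Fin.castSucc_lt_last x).ne]
    · simp [ih h.2, h.1]

/-- Only the step leaving `a` changes: it is rerouted through the new letter. -/
theorem isChain_insertLetter {π : Equiv.Perm (Fin n)} (a : Fin n) :
    ∀ {w : List (Fin n)}, w.IsChain (fun x y => π x = y) →
      (insertLetter a w).IsChain fun x y => insertAfter π a x = y
  | [], _ => by simp
  | [x], _ => by
    rw [insertLetter_cons]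
    split_ifs with h <;> simp [insertAfter_castSucc, h]
  | x :: y :: w, h => by
    rw [List.isChain_cons_cons] at h
    have ih := isChain_insertLetter a h.2
    rw [insertLetter_cons]
    have h1 : ∃ t, insertLetter a (y :: w) = y.castSucc :: t := by
      rw [insertLetter_cons]
      split_ifs <;> simp
    obtain ⟨t, ht⟩ := h1
    rw [ht] at ih ⊢
    split_ifs with hx
    · subst hx
      simp [List.isChain_cons_cons, insertAfter_castSucc, h.1, ih]
    · simp [List.isChain_cons_cons, insertAfter_castSucc, h.1, ih, hx]

/-- `L` is the standard cycle form of `π`. -/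
structure IsForm (π : Equiv.Perm (Fin n)) (L : List (List (Fin n))) : Prop where
  nodup : L.flatten.Nodup
  mem : ∀ x, x ∈ L.flatten
  cyc : ∀ c ∈ L, ∃ m l, c = m :: l ∧ (∀ x ∈ l, m < x) ∧
    (c ++ [m]).IsChain fun x y => π x = y
  desc : L.Pairwise fun c d => ∃ y ∈ d, ∀ x ∈ c, y < x

theorem eq_iterate_of_isChain {α : Type*} {f : α → α} :
    ∀ (l : List α) (m : α), (m :: l).IsChain (fun x y => f x = y) →
      m :: l = List.iterate f m (l.length + 1)
  | [], m, _ => rfl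
  | x :: l, m, h => by
    rw [List.isChain_cons_cons] at h
    rw [List.length_cons, List.iterate, h.1, ← eq_iterate_of_isChain l x h.2]

theorem sameCycle_of_isChain {α : Type*} {f : Equiv.Perm α} :
    ∀ (l : List α) (m : α), (m :: l).IsChain (fun x y => f x = y) →
      ∀ x ∈ m :: l, f.SameCycle m x
  | [], m, _, x, hx => by
    obtain rfl := List.mem_singleton.1 hx
    exact Equiv.Perm.SameCycle.refl _ _
  | y :: l, m, h, x, hx => by
    rw [List.isChain_cons_cons] at h
    rcases List.mem_cons.1 hx with rfl | hx
    · exact Equiv.Perm.SameCycle.refl _ _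
    · rw [← Equiv.Perm.sameCycle_apply_left, h.1]
      exact sameCycle_of_isChain l y h.2 x hx

/-- A chain that returns to its start is closed under `π`, so it contains every `π ^ i` applied to
`m`. -/
theorem sameCycle_iff_mem {π : Equiv.Perm (Fin n)} {m : Fin n} {l : List (Fin n)}
    (h : (m :: l ++ [m]).IsChain fun x y => π x = y) (x : Fin n) :
    π.SameCycle m x ↔ x ∈ m :: l := by
  constructor
  · intro hx
    obtain ⟨i, -, rfl⟩ := hx.exists_pow_eq'
    clear hx
    induction i with
    | zero => simp
    | succ i ih =>
      rw [pow_succ', Equiv.Perm.mul_apply]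
      generalize (π ^ i) m = y at ih
      obtain ⟨u, v, huv⟩ := List.append_of_mem ih
      rw [huv, List.append_assoc, List.cons_append] at h
      have h1 := h.right_of_append
      cases v with
      | nil =>
        simp at h1
        simp [h1]
      | cons z v =>
        simp only [List.cons_append, List.isChain_cons_cons] at h1
        rw [huv, h1.1]
        simp
  · exact sameCycle_of_isChain l m h.left_of_append x

theorem cycleWord_eq {π : Equiv.Perm (Fin n)} {m : Fin n} {l : List (Fin n)}
    (h : (m :: l ++ [m]).IsChain fun x y => π x = y) (hl : (m :: l).Nodup) :
    cycleWord π m = m :: l := by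
  rw [cycleWord, eq_iterate_of_isChain l m h.left_of_append]
  congr 1
  rw [← List.length_cons (a := m), ← List.toFinset_card_of_nodup hl]
  congr 1
  ext x
  rw [Finset.mem_filter, sameCycle_iff_mem h, List.mem_toFinset]
  simp

/-- The conditions determine the list: its heads are exactly the cycle minima, in decreasing order,
and each head determines its cycle word. Computing a cycle form thus reduces to checking `IsForm`.
-/
theorem IsForm.cycleForm_eq {π : Equiv.Perm (Fin n)} {L : List (List (Fin n))}
    (h : IsForm π L) : cycleForm π = L := by
  -- `headI` below needs an inhabited type, which `Fin 0` is not.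
  rcases n with _ | n
  · have : L = [] := by
      rcases L with _ | ⟨c, L⟩
      · rfl
      · obtain ⟨m, -⟩ := h.cyc c (by simp)
        exact m.elim0
    subst this
    simp [cycleForm, cycleMinima]
  have hhead : ∀ c ∈ L, ∃ l, c = c.headI :: l ∧ (∀ x ∈ l, c.headI < x) ∧
      (c ++ [c.headI]).IsChain fun x y => π x = y := by
    intro c hc
    obtain ⟨m, l, rfl, h1, h2⟩ := h.cyc c hc
    exact ⟨l, rfl, h1, h2⟩
  have hmin : cycleMinima π = L.map List.headI := by
    have hs1 : (cycleMinima π).Pairwise (· > ·) := by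
      refine List.Pairwise.filter _ ?_
      rw [List.pairwise_reverse]
      exact List.pairwise_lt_finRange _
    have hs2 : (L.map List.headI).Pairwise (· > ·) := by
      rw [List.pairwise_map]
      refine h.desc.imp_of_mem ?_
      rintro c d hc hd ⟨y, hy, hlt⟩
      obtain ⟨l, hl, h1, -⟩ := hhead d hd
      obtain ⟨l', hl', -⟩ := hhead c hc
      have h2 : y < c.headI := hlt _ (by rw [hl']; simp)
      refine lt_of_le_of_lt ?_ h2
      rw [hl] at hy
      rcases List.mem_cons.1 hy with hy | hy
      · exact hy.ge
      · exact (h1 y hy).le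
    refine List.Perm.eq_of_pairwise (le := (· > ·))
      (fun a b _ _ h1 h2 => absurd h1 (lt_asymm h2)) hs1 hs2 ?_
    rw [List.perm_ext_iff_of_nodup (hs1.imp fun h => h.ne') (hs2.imp fun h => h.ne')]
    intro m
    simp only [cycleMinima, List.mem_filter, List.mem_reverse, List.mem_finRange, true_and,
      decide_eq_true_eq, List.mem_map]
    constructor
    · intro hm
      obtain ⟨c, hc, hmc⟩ := List.mem_flatten.1 (h.mem m)
      obtain ⟨l, hl, h1, h2⟩ := hhead c hc
      refine ⟨c, hc, ?_⟩
      rw [hl, List.headI_cons] at h2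
      rw [hl] at hmc
      have h3 := hm _ ((sameCycle_iff_mem h2 m).2 hmc).symm
      rcases List.mem_cons.1 hmc with h4 | h4
      · exact h4.symm
      · exact absurd (h1 m h4) h3.not_gt
    · rintro ⟨c, hc, rfl⟩ j hj
      obtain ⟨l, hl, h1, h2⟩ := hhead c hc
      rw [hl, List.headI_cons] at h2
      rcases List.mem_cons.1 ((sameCycle_iff_mem h2 j).1 hj) with h4 | h4
      · exact h4.ge
      · exact (h1 j h4).le
  rw [cycleForm, hmin, List.map_map]
  refine (List.map_congr_left fun c hc => ?_).trans (List.map_id L)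
  obtain ⟨l, hl, h1, h2⟩ := hhead c hc
  have hnd : c.Nodup := (List.nodup_flatten.1 h.nodup).1 c hc
  rw [Function.comp_apply, id]
  rw [hl, List.headI_cons] at h2
  rw [cycleWord_eq h2 (hl ▸ hnd), ← hl]

theorem IsForm.addFixed {π : Equiv.Perm (Fin n)} {L : List (List (Fin n))} (h : IsForm π L) :
    IsForm (addFixed π) ([Fin.last n] :: L.map (List.map Fin.castSucc)) where
  nodup := by
    rw [List.flatten_cons, ← List.map_flatten]
    simp only [List.cons_append, List.nil_append, List.nodup_cons]
    exact ⟨by simp, h.nodup.map (Fin.castSucc_injective n)⟩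
  mem x := by
    rw [List.flatten_cons, ← List.map_flatten]
    induction x using Fin.lastCases with
    | last => simp
    | cast x =>
      rw [List.mem_append]
      exact Or.inr (List.mem_map_of_mem (h.mem x))
  cyc c hc := by
    rcases List.mem_cons.1 hc with rfl | hc
    · exact ⟨Fin.last n, [], rfl, by simp, by simp⟩
    · obtain ⟨d, hd, rfl⟩ := List.mem_map.1 hc
      obtain ⟨m, l, rfl, h1, h2⟩ := h.cyc d hd
      refine ⟨m.castSucc, l.map Fin.castSucc, rfl, by simpa using h1, ?_⟩
      have : (m :: l).map Fin.castSucc ++ [m.castSucc] = (m :: l ++ [m]).map Fin.castSucc := by simp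
      rw [this, List.isChain_map]
      simpa using h2
  desc := by
    rw [List.pairwise_cons]
    constructor
    · intro c hc
      obtain ⟨d, hd, rfl⟩ := List.mem_map.1 hc
      obtain ⟨m, l, rfl, -⟩ := h.cyc d hd
      exact ⟨m.castSucc, by simp, by simp [Fin.castSucc_lt_last]⟩
    · rw [List.pairwise_map]
      refine h.desc.imp ?_
      rintro c d ⟨y, hy, hlt⟩
      exact ⟨y.castSucc, by simpa using hy, by simpa using hlt⟩

theorem IsForm.insertAfter {π : Equiv.Perm (Fin n)} {L : List (List (Fin n))} (h : IsForm π L)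
    (a : Fin n) : IsForm (insertAfter π a) (L.map (insertLetter a)) where
  nodup := by
    rw [flatten_map_insertLetter]
    exact nodup_insertLetter h.nodup
  mem x := by
    rw [flatten_map_insertLetter]
    induction x using Fin.lastCases with
    | last => simpa using h.mem a
    | cast x => simpa using h.mem x
  cyc c hc := by
    obtain ⟨d, hd, rfl⟩ := List.mem_map.1 hc
    obtain ⟨m, l, rfl, h1, h2⟩ := h.cyc d hd
    obtain ⟨t, ht⟩ : ∃ t, insertLetter a (m :: l) = m.castSucc :: t := by
      rw [insertLetter_cons]
      split_ifs <;> simp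
    have hnd : (insertLetter a (m :: l)).Nodup :=
      nodup_insertLetter ((List.nodup_flatten.1 h.nodup).1 _ hd)
    refine ⟨m.castSucc, t, ht, ?_, ?_⟩
    · intro x hx
      induction x using Fin.lastCases with
      | last => exact Fin.castSucc_lt_last m
      | cast x =>
        rw [Fin.castSucc_lt_castSucc_iff]
        have hx' : x ∈ m :: l := castSucc_mem_insertLetter.1 (ht ▸ List.mem_cons_of_mem _ hx)
        rcases List.mem_cons.1 hx' with rfl | hx'
        · rw [ht, List.nodup_cons] at hnd
          exact absurd hx hnd.1
        · exact h1 x hx'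
    · have h3 := isChain_insertLetter a h2
      rw [insertLetter_append, insertLetter_cons a m []] at h3
      split_ifs at h3
      -- When `a = m`, the closing copy of `m` also receives the new letter; that superfluous final
      -- letter is dropped.
      · have : insertLetter a (m :: l) ++ ([m.castSucc, Fin.last n] ++ insertLetter a []) =
          (insertLetter a (m :: l) ++ [m.castSucc]) ++ [Fin.last n] := by simp
        rw [this] at h3
        exact h3.left_of_append
      · exact h3
  desc := by
    rw [List.pairwise_map]
    refine h.desc.imp ?_
    rintro c d ⟨y, hy, hlt⟩
    refine ⟨y.castSucc, by simpa using hy, fun x hx => ?_⟩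
    induction x using Fin.lastCases with
    | last => exact Fin.castSucc_lt_last y
    | cast x => simpa using hlt x (by simpa using hx)

/-- Induction on the size: every permutation arises by adding the largest letter, and both ways of
adding it preserve `IsForm`. -/
theorem isForm_cycleForm : ∀ {n : ℕ} (π : Equiv.Perm (Fin n)), IsForm π (cycleForm π) := by
  intro n
  induction n with
  | zero =>
    intro π
    have : cycleForm π = [] := by simp [cycleForm, cycleMinima]
    rw [this]
    exact ⟨by simp, fun x => x.elim0, by simp, by simp⟩
  | succ n ih =>
    intro τ
    rcases eq_addFixed_or_insertAfter τ with ⟨π, rfl⟩ | ⟨π, a, rfl⟩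
    · rw [(ih π).addFixed.cycleForm_eq]
      exact (ih π).addFixed
    · rw [((ih π).insertAfter a).cycleForm_eq]
      exact (ih π).insertAfter a

theorem cycleForm_addFixed (π : Equiv.Perm (Fin n)) :
    cycleForm (addFixed π) = [Fin.last n] :: (cycleForm π).map (List.map Fin.castSucc) :=
  (isForm_cycleForm π).addFixed.cycleForm_eq

theorem cycleForm_insertAfter (π : Equiv.Perm (Fin n)) (a : Fin n) :
    cycleForm (insertAfter π a) = (cycleForm π).map (insertLetter a) :=
  ((isForm_cycleForm π).insertAfter a).cycleForm_eq

theorem flatten_cycleForm_addFixed (π : Equiv.Perm (Fin n)) :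
    (cycleForm (addFixed π)).flatten =
      Fin.last n :: (cycleForm π).flatten.map Fin.castSucc := by
  rw [cycleForm_addFixed, List.flatten_cons, List.map_flatten]
  rfl

/-- The effect of `insertAfter` on the word of the cycle form. -/
theorem flatten_cycleForm_insertAfter (π : Equiv.Perm (Fin n)) {a : Fin n} {u v : List (Fin n)}
    (h : (cycleForm π).flatten = u ++ a :: v) :
    (cycleForm (insertAfter π a)).flatten =
      (u ++ [a]).map Fin.castSucc ++ Fin.last n :: v.map Fin.castSucc := by
  have hnd := (isForm_cycleForm π).nodup
  rw [h, List.nodup_append, List.nodup_cons] at hnd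
  rw [cycleForm_insertAfter, flatten_map_insertLetter, h, insertLetter_append_cons _ hnd.2.1.1]
  exact fun ha => hnd.2.2 a ha a (by simp) rfl

end CycleForms

/-! ### Pattern occurrences created by a new largest letter. -/

section Patterns

variable {α : Type*} [LinearOrder α]

theorem occurs_three_iff {σ : Fin 3 → ℕ} {w : List α} :
    Occurs σ w ↔ ∃ x y z, [x, y, z].Sublist w ∧
      ∀ a b : Fin 3, ![x, y, z] a < ![x, y, z] b ↔ σ a < σ b := by
  constructor
  · rintro ⟨f, hf⟩
    have hv : ∀ a, ![w.get (f 0), w.get (f 1), w.get (f 2)] a = w.get (f a) := by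
      intro a
      fin_cases a <;> rfl
    refine ⟨w.get (f 0), w.get (f 1), w.get (f 2), ?_, fun a b => by rw [hv, hv, hf]⟩
    rw [List.sublist_iff_exists_fin_orderEmbedding_get_eq]
    refine ⟨f, fun (a : Fin 3) => ?_⟩
    rw [← hv]
    fin_cases a <;> rfl
  · rintro ⟨x, y, z, h, hσ⟩
    rw [List.sublist_iff_exists_fin_orderEmbedding_get_eq] at h
    obtain ⟨f, hf⟩ := h
    refine ⟨f, fun a b => ?_⟩
    rw [← hσ, ← hf, ← hf]
    have hv : ∀ a : Fin 3, [x, y, z].get a = ![x, y, z] a := by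
      intro a
      fin_cases a <;> rfl
    rw [hv, hv]

/-- The word contains an increasing subword of length three. -/
def Has123 (w : List α) : Prop := ∃ x y z, [x, y, z].Sublist w ∧ x < y ∧ y < z

/-- The word contains a subword in the same relative order as `132`. -/
def Has132 (w : List α) : Prop := ∃ x y z, [x, y, z].Sublist w ∧ x < z ∧ z < y

theorem occurs_123_iff {w : List α} : Occurs ![1, 2, 3] w ↔ Has123 w := by
  rw [occurs_three_iff]
  refine exists_congr fun x => exists_congr fun y => exists_congr fun z => and_congr_right fun _ => ?_
  constructor
  · intro h
    exact ⟨(h 0 1).2 (by decide), (h 1 2).2 (by decide)⟩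
  · rintro ⟨h1, h2⟩
    simp [Fin.forall_fin_succ, h1, h2, h1.trans h2, h1.le, h2.le, (h1.trans h2).le]

theorem occurs_132_iff {w : List α} : Occurs ![1, 3, 2] w ↔ Has132 w := by
  rw [occurs_three_iff]
  refine exists_congr fun x => exists_congr fun y => exists_congr fun z => and_congr_right fun _ => ?_
  constructor
  · intro h
    exact ⟨(h 0 2).2 (by decide), (h 2 1).2 (by decide)⟩
  · rintro ⟨h1, h2⟩
    simp [Fin.forall_fin_succ, h1, h2, h1.trans h2, h1.le, h2.le, (h1.trans h2).le]

/-- Case distinction on the place of `M` in the triple, if it is used at all. -/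
theorem triple_sublist_insert {M x y z : α} {U V : List α} (hM : ∀ w ∈ U ++ V, w < M)
    (h : [x, y, z].Sublist (U ++ M :: V)) :
    [x, y, z].Sublist (U ++ V) ∨ (x = M ∧ y ∈ V) ∨ (y = M ∧ x ∈ U ∧ z ∈ V) ∨
      (z = M ∧ [x, y].Sublist U) := by
  obtain ⟨l, l', hl, h1, h2⟩ := List.sublist_append_iff.1 h
  have hU : M ∉ U := fun h => (hM M (by simp [h])).false
  rcases List.sublist_cons_iff.1 h2 with h3 | ⟨r, rfl, h3⟩
  · exact Or.inl (hl ▸ h1.append h3)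
  · right
    rcases l with _ | ⟨p, _ | ⟨q, _ | ⟨t, l⟩⟩⟩
    · simp at hl
      obtain ⟨rfl, rfl⟩ := hl
      exact Or.inl ⟨rfl, h3.subset (by simp)⟩
    · simp at hl
      obtain ⟨rfl, rfl, rfl⟩ := hl
      exact Or.inr (Or.inl ⟨rfl, h1.subset (by simp), h3.subset (by simp)⟩)
    · simp at hl
      obtain ⟨rfl, rfl, rfl, rfl⟩ := hl
      exact Or.inr (Or.inr ⟨rfl, h1⟩)
    · simp at hl

/-- The maximum `M` can only be the last letter of an increasing triple. -/
theorem has123_insert {M : α} {U V : List α} (hM : ∀ w ∈ U ++ V, w < M) :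
    Has123 (U ++ M :: V) ↔ Has123 (U ++ V) ∨ ∃ x y, [x, y].Sublist U ∧ x < y := by
  constructor
  · rintro ⟨x, y, z, h, hxy, hyz⟩
    rcases triple_sublist_insert hM h with h | ⟨rfl, h'⟩ | ⟨rfl, -, h'⟩ | ⟨rfl, h'⟩
    · exact Or.inl ⟨x, y, z, h, hxy, hyz⟩
    · exact absurd (hM y (by simp [h'])) hxy.not_gt
    · exact absurd (hM z (by simp [h'])) hyz.not_gt
    · exact Or.inr ⟨x, y, h', hxy⟩
  · rintro (⟨x, y, z, h, h'⟩ | ⟨x, y, h, hxy⟩)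
    · exact ⟨x, y, z, h.trans ((List.sublist_cons_self M V).append_left U), h'⟩
    · refine ⟨x, y, M, h.append (List.singleton_sublist.2 (by simp)), hxy, hM y ?_⟩
      exact List.mem_append_left _ (h.subset (by simp))

/-- The maximum `M` can only be the middle letter of an occurrence. -/
theorem has132_insert {M : α} {U V : List α} (hM : ∀ w ∈ U ++ V, w < M) :
    Has132 (U ++ M :: V) ↔ Has132 (U ++ V) ∨ ∃ x ∈ U, ∃ z ∈ V, x < z := by
  constructor
  · rintro ⟨x, y, z, h, hxz, hzy⟩
    rcases triple_sublist_insert hM h with h | ⟨rfl, h'⟩ | ⟨rfl, hx, hz⟩ | ⟨rfl, h'⟩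
    · exact Or.inl ⟨x, y, z, h, hxz, hzy⟩
    · exact absurd (hM y (by simp [h'])) (hxz.trans hzy).not_gt
    · exact Or.inr ⟨x, hx, z, hz, hxz⟩
    · exact absurd (hM y (List.mem_append_left _ (h'.subset (by simp)))) hzy.not_gt
  · rintro (⟨x, y, z, h, h'⟩ | ⟨x, hx, z, hz, hxz⟩)
    · exact ⟨x, y, z, h.trans ((List.sublist_cons_self M V).append_left U), h'⟩
    · refine ⟨x, M, z, (List.singleton_sublist.2 hx).append
        (List.Sublist.cons_cons M (List.singleton_sublist.2 hz)), hxz, hM z (by simp [hz])⟩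

theorem has123_map {β : Type*} [LinearOrder β] {f : α → β} (hf : StrictMono f) {w : List α} :
    Has123 (w.map f) ↔ Has123 w := by
  constructor
  · rintro ⟨x, y, z, h, hxy, hyz⟩
    obtain ⟨l, hl, he⟩ := List.sublist_map_iff.1 h
    obtain ⟨x', lx, rfl, rfl, hex⟩ := List.map_eq_cons_iff.1 he.symm
    obtain ⟨y', ly, rfl, rfl, hey⟩ := List.map_eq_cons_iff.1 hex
    obtain ⟨z', lz, rfl, rfl, hez⟩ := List.map_eq_cons_iff.1 hey
    rw [List.map_eq_nil_iff] at hez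
    subst hez
    exact ⟨x', y', z', hl, hf.lt_iff_lt.1 hxy, hf.lt_iff_lt.1 hyz⟩
  · rintro ⟨x, y, z, h, hxy, hyz⟩
    exact ⟨f x, f y, f z, h.map f, hf hxy, hf hyz⟩

theorem has132_map {β : Type*} [LinearOrder β] {f : α → β} (hf : StrictMono f) {w : List α} :
    Has132 (w.map f) ↔ Has132 w := by
  constructor
  · rintro ⟨x, y, z, h, hxy, hyz⟩
    obtain ⟨l, hl, he⟩ := List.sublist_map_iff.1 h
    obtain ⟨x', lx, rfl, rfl, hex⟩ := List.map_eq_cons_iff.1 he.symm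
    obtain ⟨y', ly, rfl, rfl, hey⟩ := List.map_eq_cons_iff.1 hex
    obtain ⟨z', lz, rfl, rfl, hez⟩ := List.map_eq_cons_iff.1 hey
    rw [List.map_eq_nil_iff] at hez
    subst hez
    exact ⟨x', y', z', hl, hf.lt_iff_lt.1 hxy, hf.lt_iff_lt.1 hyz⟩
  · rintro ⟨x, y, z, h, hxy, hyz⟩
    exact ⟨f x, f y, f z, h.map f, hf hxy, hf hyz⟩

variable {n : ℕ}

theorem lt_last_of_mem_map {U V : List (Fin n)} :
    ∀ w ∈ U.map Fin.castSucc ++ V.map Fin.castSucc, w < Fin.last n := by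
  intro w hw
  rw [← List.map_append, List.mem_map] at hw
  obtain ⟨x, -, rfl⟩ := hw
  exact Fin.castSucc_lt_last x

theorem cyclicallyAvoids_123_addFixed {π : Equiv.Perm (Fin n)} :
    CyclicallyAvoids ![1, 2, 3] (addFixed π) ↔ CyclicallyAvoids ![1, 2, 3] π := by
  rw [CyclicallyAvoids, CyclicallyAvoids, occurs_123_iff, occurs_123_iff,
    flatten_cycleForm_addFixed]
  have := has123_insert (lt_last_of_mem_map (U := []) (V := (cycleForm π).flatten))
  simp only [List.map_nil, List.nil_append] at this
  rw [this, has123_map (Fin.strictMono_castSucc)]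
  simp

theorem cyclicallyAvoids_132_addFixed {π : Equiv.Perm (Fin n)} :
    CyclicallyAvoids ![1, 3, 2] (addFixed π) ↔ CyclicallyAvoids ![1, 3, 2] π := by
  rw [CyclicallyAvoids, CyclicallyAvoids, occurs_132_iff, occurs_132_iff,
    flatten_cycleForm_addFixed]
  have := has132_insert (lt_last_of_mem_map (U := []) (V := (cycleForm π).flatten))
  simp only [List.map_nil, List.nil_append] at this
  rw [this, has132_map (Fin.strictMono_castSucc)]
  simp

theorem cyclicallyAvoids_123_insertAfter {π : Equiv.Perm (Fin n)} {a : Fin n}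
    {u v : List (Fin n)} (h : (cycleForm π).flatten = u ++ a :: v) :
    CyclicallyAvoids ![1, 2, 3] (insertAfter π a) ↔
      CyclicallyAvoids ![1, 2, 3] π ∧ (u ++ [a]).Pairwise (· ≥ ·) := by
  rw [CyclicallyAvoids, CyclicallyAvoids, occurs_123_iff, occurs_123_iff,
    flatten_cycleForm_insertAfter π h, has123_insert lt_last_of_mem_map, not_or,
    ← List.map_append, has123_map (Fin.strictMono_castSucc), h, List.append_assoc,
    List.singleton_append, List.pairwise_iff_forall_sublist]
  refine and_congr_right fun _ => ?_
  push Not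
  constructor
  · intro h x y hxy
    exact Fin.castSucc_le_castSucc_iff.1 (h x.castSucc y.castSucc (hxy.map Fin.castSucc))
  · intro h x y hxy
    obtain ⟨l, hl, he⟩ := List.sublist_map_iff.1 hxy
    obtain ⟨x', lx, rfl, rfl, hex⟩ := List.map_eq_cons_iff.1 he.symm
    obtain ⟨y', ly, rfl, rfl, hey⟩ := List.map_eq_cons_iff.1 hex
    rw [List.map_eq_nil_iff] at hey
    subst hey
    exact Fin.castSucc_le_castSucc_iff.2 (h hl)

theorem cyclicallyAvoids_132_insertAfter {π : Equiv.Perm (Fin n)} {a : Fin n}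
    {u v : List (Fin n)} (h : (cycleForm π).flatten = u ++ a :: v) :
    CyclicallyAvoids ![1, 3, 2] (insertAfter π a) ↔
      CyclicallyAvoids ![1, 3, 2] π ∧ ∀ x ∈ u ++ [a], ∀ z ∈ v, z ≤ x := by
  rw [CyclicallyAvoids, CyclicallyAvoids, occurs_132_iff, occurs_132_iff,
    flatten_cycleForm_insertAfter π h, has132_insert lt_last_of_mem_map, not_or,
    ← List.map_append, has132_map (Fin.strictMono_castSucc), h, List.append_assoc,
    List.singleton_append]
  refine and_congr_right fun _ => ?_
  simp only [List.mem_map]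
  push Not
  simp only [forall_exists_index, and_imp, forall_apply_eq_imp_iff₂, Fin.castSucc_le_castSucc_iff]

end Patterns

/-! ### The operators for 1–2–3. -/

section Operators

variable {n : ℕ}

theorem numCycles_addFixed (π : Equiv.Perm (Fin n)) :
    numCycles (addFixed π) = numCycles π + 1 := by
  simp [numCycles, cycleForm_addFixed]

theorem numCycles_insertAfter (π : Equiv.Perm (Fin n)) (a : Fin n) :
    numCycles (insertAfter π a) = numCycles π := by
  simp [numCycles, cycleForm_insertAfter]

theorem IsForm.ne_nil {π : Equiv.Perm (Fin n)} {L : List (List (Fin n))} (h : IsForm π L)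
    {c : List (Fin n)} (hc : c ∈ L) : c ≠ [] := by
  obtain ⟨m, l, rfl, -⟩ := h.cyc c hc
  simp

theorem rho_succ_eq_some_iff {π : Equiv.Perm (Fin n)} {j : ℕ} {τ : Equiv.Perm (Fin (n + 1))} :
    rho (j + 1) π = some τ ↔ ∃ A a l B, cycleForm π = A ++ (a :: l) :: B ∧ A.length = j ∧
      (∀ c ∈ A, c.length < 2) ∧ τ = insertAfter π a := by
  rw [rho]
  constructor
  · intro h
    split_ifs at h with hj
    simp only [Option.map_eq_some_iff, Option.bind_eq_some_iff] at h
    obtain ⟨a, ⟨c, hc, hca⟩, rfl⟩ := h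
    obtain ⟨hlt, hc⟩ := List.getElem?_eq_some_iff.1 hc
    obtain ⟨l, rfl⟩ := List.head?_eq_some_iff.1 hca
    refine ⟨(cycleForm π).take j, a, l, (cycleForm π).drop (j + 1), ?_, ?_, ?_, rfl⟩
    · rw [← hc, List.cons_getElem_drop_succ, List.take_append_drop]
    · simp [hlt.le]
    · intro c hc
      obtain ⟨i, hi, rfl⟩ := List.mem_iff_getElem.1 hc
      rw [List.length_take] at hi
      have := List.not_of_lt_findIdx (xs := cycleForm π) (p := fun c => decide (2 ≤ c.length))
        (i := i) (by omega)
      simpa using this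
  · rintro ⟨A, a, l, B, h, rfl, hA, rfl⟩
    have hf : A.findIdx (fun c => decide (2 ≤ c.length)) = A.length := by
      rw [List.findIdx_eq_length]
      intro c hc
      simpa using hA c hc
    rw [h, List.findIdx_append, hf, if_neg (lt_irrefl _), if_pos (by omega)]
    simp

/-- The number of admissible nonzero indices for the operators `rho`. -/
def rhoLabel (π : Equiv.Perm (Fin n)) : ℕ :=
  min ((cycleForm π).findIdx (fun c => 2 ≤ c.length) + 1) (cycleForm π).length

/-- `findIdx` counts from 0 and returns the length if no cycle is long; hence the `+ 1` and the
`min` in `rhoLabel`. -/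
theorem isSome_rho_iff (i : ℕ) (π : Equiv.Perm (Fin n)) :
    (rho i π).isSome ↔ i ≤ rhoLabel π := by
  rcases i with _ | j
  · simp [rho]
  · rw [rho, rhoLabel]
    split_ifs with h
    · constructor
      · intro h1
        rw [Option.isSome_map, Option.isSome_iff_exists] at h1
        obtain ⟨a, h1⟩ := h1
        obtain ⟨c, hc, -⟩ := Option.bind_eq_some_iff.1 h1
        obtain ⟨hlt, -⟩ := List.getElem?_eq_some_iff.1 hc
        omega
      · intro h1
        have hlt : j < (cycleForm π).length := by omega
        rw [List.getElem?_eq_getElem hlt]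
        simpa using (isForm_cycleForm π).ne_nil (List.getElem_mem hlt)
    · simp only [Option.isSome_none, Bool.false_eq_true, false_iff]
      omega

theorem rhoLabel_addFixed (π : Equiv.Perm (Fin n)) :
    rhoLabel (addFixed π) = rhoLabel π + 1 := by
  rw [rhoLabel, rhoLabel, cycleForm_addFixed, List.findIdx_cons, List.findIdx_map]
  simp [Function.comp_def]

theorem map_insertLetter_of_notMem {a : Fin n} {A : List (List (Fin n))} (h : a ∉ A.flatten) :
    A.map (insertLetter a) = A.map (List.map Fin.castSucc) := by
  refine List.map_congr_left fun c hc => insertLetter_of_notMem fun hac => h ?_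
  exact List.mem_flatten.2 ⟨c, hc, hac⟩

theorem IsForm.disjoint_of_append {π : Equiv.Perm (Fin n)} {A B : List (List (Fin n))}
    {u v : List (Fin n)} {a : Fin n} (h : IsForm π (A ++ (u ++ a :: v) :: B)) :
    a ∉ A.flatten ∧ a ∉ u ∧ a ∉ v ∧ a ∉ B.flatten := by
  have hnd := h.nodup
  simp only [List.flatten_append, List.flatten_cons, List.append_assoc, List.cons_append] at hnd
  rw [List.nodup_append] at hnd
  have h2 := hnd.2.1
  rw [List.nodup_append, List.nodup_cons, List.mem_append, not_or] at h2
  exact ⟨fun ha => hnd.2.2 a ha a (by simp) rfl, fun ha => h2.2.2 a ha a (by simp) rfl,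
    h2.2.1.1.1, h2.2.1.1.2⟩

theorem isCatalanTree_rho : IsCatalanTree (X := fun n => Equiv.Perm (Fin n)) rhoSeq
    (fun _ => rho) (fun _ => rhoLabel) (fun _ => numCycles)
    (fun _ π => CyclicallyAvoids ![1, 2, 3] π) where
  root := ⟨1, fun _ => rfl, by
      simp [CyclicallyAvoids, occurs_123_iff, cycleForm, cycleMinima, Has123],
    by simp [rhoLabel, cycleForm, cycleMinima], by simp [numCycles, cycleForm, cycleMinima],
    fun y _ => Subsingleton.elim _ _⟩
  seq_succ n s := rfl
  isSome_op n i π _ := isSome_rho_iff i π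
  good_op n i π τ hπ h := by
    rcases i with _ | j
    · cases h
      exact cyclicallyAvoids_123_addFixed.2 hπ
    · obtain ⟨A, a, l, B, hL, -, hA, rfl⟩ := rho_succ_eq_some_iff.1 h
      refine (cyclicallyAvoids_123_insertAfter (u := A.flatten) (v := l ++ B.flatten)
        (by simp [hL])).2 ⟨hπ, ?_⟩
      have hF := isForm_cycleForm π
      rw [hL] at hF
      -- The prefix ending in `a` consists of cycle minima only, and these decrease in standard
      -- form.
      have hA' : ∀ c ∈ A ++ [[a]], ∃ x, c = [x] := by
        intro c hc
        rcases List.mem_append.1 hc with hc | hc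
        · obtain ⟨m, l, rfl, -⟩ := hF.cyc c (by simp [hc])
          have := hA _ hc
          exact ⟨m, by simpa using this⟩
        · exact ⟨a, by simpa using hc⟩
      have hfl : A.flatten ++ [a] = (A ++ [[a]]).flatten := by simp
      rw [hfl, List.pairwise_flatten]
      refine ⟨fun c hc => ?_, ?_⟩
      · obtain ⟨x, rfl⟩ := hA' c hc
        simp
      · have hd := hF.desc
        rw [List.pairwise_append] at hd ⊢
        refine ⟨hd.1.imp_of_mem ?_, by simp, ?_⟩
        · rintro c d hc hd ⟨y, hy, hlt⟩
          obtain ⟨x, rfl⟩ := hA' d (by simp [hd])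
          obtain rfl := List.mem_singleton.1 hy
          intro z hz t ht
          obtain rfl := List.mem_singleton.1 ht
          exact (hlt z hz).le
        · intro c hc d hd' x hx y hy
          obtain rfl := List.mem_singleton.1 hd'
          obtain rfl := List.mem_singleton.1 hy
          obtain ⟨z, hz, hlt⟩ := hd.2.2 c hc (y :: l) (by simp)
          obtain ⟨m, l', he, hm, -⟩ := hF.cyc (y :: l) (by simp)
          cases he
          rcases List.mem_cons.1 hz with rfl | hz
          · exact (hlt x hx).le
          · exact ((hm z hz).trans (hlt x hx)).le
  lab_op n i π τ _ h := by
    rcases i with _ | j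
    · cases h
      exact rhoLabel_addFixed π
    · obtain ⟨A, a, l, B, hL, rfl, hA, rfl⟩ := rho_succ_eq_some_iff.1 h
      have hF := isForm_cycleForm π
      rw [hL] at hF
      have hd := hF.disjoint_of_append (u := [])
      rw [if_neg (by omega), rhoLabel, cycleForm_insertAfter, hL, List.map_append,
        map_insertLetter_of_notMem hd.1, List.map_cons, insertLetter_cons, List.findIdx_append]
      have hf : (A.map (List.map Fin.castSucc)).findIdx
          (fun c : List (Fin (n + 1)) => decide (2 ≤ c.length)) = A.length := by
        rw [List.findIdx_map, List.findIdx_eq_length]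
        intro c hc
        simpa using hA c hc
      rw [hf]
      simp [List.findIdx_cons]
  st_op n i π τ _ h := by
    rcases i with _ | j
    · cases h
      exact numCycles_addFixed π
    · obtain ⟨A, a, l, B, hL, -, hA, rfl⟩ := rho_succ_eq_some_iff.1 h
      exact numCycles_insertAfter π a
  exists_op n τ hτ := by
    rcases eq_addFixed_or_insertAfter τ with ⟨π, rfl⟩ | ⟨π, a, rfl⟩
    · exact ⟨0, π, cyclicallyAvoids_123_addFixed.1 hτ, rfl⟩
    · have hF := isForm_cycleForm π
      obtain ⟨c, hc, hac⟩ := List.mem_flatten.1 (hF.mem a)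
      obtain ⟨A, B, hL⟩ := List.append_of_mem hc
      obtain ⟨m, l, rfl, hm, -⟩ := hF.cyc c hc
      obtain ⟨u, v, huv⟩ := List.append_of_mem hac
      rw [cyclicallyAvoids_123_insertAfter (u := A.flatten ++ u) (v := v ++ B.flatten)
        (by simp [hL, huv])] at hτ
      obtain ⟨hπ, hp⟩ := hτ
      refine ⟨A.length + 1, π, hπ, rho_succ_eq_some_iff.2 ⟨A, m, l, B, hL, rfl, ?_, ?_⟩⟩
      · intro c hc
        obtain ⟨m', l', rfl, hm', -⟩ := hF.cyc c (by simp [hL, hc])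
        -- A second letter in an earlier cycle would form an ascent with its head, inside a
        -- decreasing prefix.
        rcases l' with _ | ⟨x, l'⟩
        · simp
        · rw [List.append_assoc, List.pairwise_append] at hp
          have h1 := (List.pairwise_flatten.1 hp.1).1 _ hc
          rw [List.pairwise_cons] at h1
          exact absurd (hm' x (by simp)) (h1.1 x (by simp)).not_gt
      -- If `a` did not head its cycle, the head and `a` would form an ascent in the prefix.
      · rcases u with _ | ⟨x, u⟩
        · cases huv
          rfl
        · obtain ⟨rfl, rfl⟩ := List.cons.inj huv
          rw [List.append_assoc, List.pairwise_append] at hp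
          have h1 := hp.2.1
          rw [List.cons_append, List.pairwise_cons] at h1
          exact absurd (hm a (by simp)) (h1.1 a (by simp)).not_gt
  op_inj n i j π σ τ _ _ hi hj := by
    rcases i with _ | i <;> rcases j with _ | j
    · cases hi
      exact ⟨rfl, addFixed_injective (Option.some.inj hj).symm⟩
    · obtain ⟨A, a, l, B, hL, -, hA, rfl⟩ := rho_succ_eq_some_iff.1 hj
      exact absurd (Option.some.inj hi) (addFixed_ne_insertAfter _ _ _)
    · obtain ⟨A, a, l, B, hL, -, hA, rfl⟩ := rho_succ_eq_some_iff.1 hi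
      exact absurd (Option.some.inj hj) (addFixed_ne_insertAfter _ _ _)
    · obtain ⟨A, a, l, B, hL, rfl, -, rfl⟩ := rho_succ_eq_some_iff.1 hi
      obtain ⟨A', a', l', B', hL', rfl, -, he⟩ := rho_succ_eq_some_iff.1 hj
      obtain ⟨rfl, rfl⟩ := insertAfter_inj he
      refine ⟨?_, rfl⟩
      have hF := isForm_cycleForm π
      have hnd := hF.nodup
      have hd := (hL ▸ hF).disjoint_of_append (u := [])
      have hd' := (hL' ▸ hF).disjoint_of_append (u := [])
      -- The index is the position of the cycle with head `a`; two different positions would make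
      -- `a` occur twice.
      rw [hL, List.append_eq_append_iff] at hL'
      rcases hL' with ⟨as, h1, h2⟩ | ⟨bs, h1, h2⟩
      · rcases as with _ | ⟨x, as⟩
        · simp [h1]
        · obtain ⟨rfl, -⟩ := List.cons.inj h2
          exact absurd (by simp [h1]) hd'.1
      · rcases bs with _ | ⟨x, bs⟩
        · simp [h1]
        · obtain ⟨rfl, -⟩ := List.cons.inj h2
          exact absurd (by simp [h1]) hd.1

end Operators

/-! ### Dominating cycles. -/

section DominatingCycles

variable {α : Type*} [LinearOrder α]

theorem dominatingCycles_cons_pos {c : List α} {cs : List (List α)}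
    (h : ∀ y ∈ c, ∀ x ∈ cs.flatten, x < y) :
    dominatingCycles (c :: cs) = c :: dominatingCycles cs := by
  rw [dominatingCycles, if_pos h]

theorem dominatingCycles_cons_neg {c : List α} {cs : List (List α)}
    (h : ¬ ∀ y ∈ c, ∀ x ∈ cs.flatten, x < y) :
    dominatingCycles (c :: cs) = dominatingCycles cs := by
  rw [dominatingCycles, if_neg h]

theorem dominatingCycles_map {β : Type*} [LinearOrder β] {f : α → β} (hf : StrictMono f)
    (L : List (List α)) :
    dominatingCycles (L.map (List.map f)) = (dominatingCycles L).map (List.map f) := by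
  induction L with
  | nil => rfl
  | cons c L ih =>
    have h0 : (∀ y ∈ c.map f, ∀ x ∈ (L.map (List.map f)).flatten, x < y) ↔
        ∀ y ∈ c, ∀ x ∈ L.flatten, x < y := by
      rw [← List.map_flatten]
      simp only [List.mem_map, forall_exists_index, and_imp, forall_apply_eq_imp_iff₂,
        hf.lt_iff_lt]
    rw [List.map_cons]
    by_cases h : ∀ y ∈ c, ∀ x ∈ L.flatten, x < y
    · rw [dominatingCycles_cons_pos (h0.2 h), dominatingCycles_cons_pos h, ih, List.map_cons]
    · rw [dominatingCycles_cons_neg (h0.not.2 h), dominatingCycles_cons_neg h, ih]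

/-- Used for cycles left of the one that receives the largest letter: they all stop dominating. -/
theorem dominatingCycles_append {A B : List (List α)}
    (h : ∀ c ∈ A, ∃ y ∈ c, ∃ x ∈ B.flatten, y ≤ x) :
    dominatingCycles (A ++ B) = dominatingCycles B := by
  induction A with
  | nil => rfl
  | cons c A ih =>
    rw [List.cons_append, dominatingCycles_cons_neg, ih fun d hd => h d (List.mem_cons_of_mem _ hd)]
    intro hc
    obtain ⟨y, hy, x, hx, hyx⟩ := h c (by simp)
    exact (hc y hy x (by
      rw [List.flatten_append, List.mem_append]
      exact Or.inr hx)).not_ge hyx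

/-- Domination depends only on what stands to the right, so a dominating cycle is indexed from the
right by the number of dominating cycles in its tail. -/
theorem reverse_dominatingCycles_getElem? {L : List (List α)} {j : ℕ} {d : List α} :
    (dominatingCycles L).reverse[j]? = some d ↔ ∃ A B, L = A ++ d :: B ∧
      (dominatingCycles B).length = j ∧ ∀ y ∈ d, ∀ x ∈ B.flatten, x < y := by
  induction L with
  | nil => simp [dominatingCycles]
  | cons c L ih =>
    by_cases h : ∀ y ∈ c, ∀ x ∈ L.flatten, x < y
    · rw [dominatingCycles_cons_pos h, List.reverse_cons]
      constructor
      · intro hj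
        rcases lt_or_ge j (dominatingCycles L).length with hlt | hge
        · rw [List.getElem?_append_left (by simpa using hlt)] at hj
          obtain ⟨A, B, rfl, hB⟩ := ih.1 hj
          exact ⟨c :: A, B, rfl, hB⟩
        · rw [List.getElem?_append_right (by simpa using hge), List.length_reverse,
            List.getElem?_singleton] at hj
          split_ifs at hj with h0
          cases hj
          exact ⟨[], L, rfl, by omega, h⟩
      · rintro ⟨A, B, hL, hj, hB⟩
        rcases A with _ | ⟨a, A⟩
        · cases hL
          simp [← hj]
        · obtain ⟨rfl, rfl⟩ := List.cons.inj hL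
          have h1 := ih.2 ⟨A, B, rfl, hj, hB⟩
          rw [List.getElem?_append_left (List.getElem?_eq_some_iff.1 h1).1, h1]
    · rw [dominatingCycles_cons_neg h, ih]
      constructor
      · rintro ⟨A, B, rfl, hB⟩
        exact ⟨c :: A, B, rfl, hB⟩
      · rintro ⟨A, B, hL, hj, hB⟩
        rcases A with _ | ⟨a, A⟩
        · cases hL
          exact absurd hB h
        · obtain ⟨rfl, rfl⟩ := List.cons.inj hL
          exact ⟨A, B, rfl, hj, hB⟩

end DominatingCycles

/-! ### The operators for 1–3–2. -/

section Operators

variable {n : ℕ}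

theorem rho'_succ_eq_some_iff {π : Equiv.Perm (Fin n)} {j : ℕ} {τ : Equiv.Perm (Fin (n + 1))} :
    rho' (j + 1) π = some τ ↔ ∃ A l a B, cycleForm π = A ++ (l ++ [a]) :: B ∧
      (dominatingCycles B).length = j ∧ (∀ y ∈ l ++ [a], ∀ x ∈ B.flatten, x < y) ∧
      τ = insertAfter π a := by
  simp only [rho', Option.map_eq_some_iff, Option.bind_eq_some_iff,
    reverse_dominatingCycles_getElem?, List.getLast?_eq_some_iff]
  constructor
  · rintro ⟨a, ⟨d, ⟨A, B, hL, hj, hB⟩, l, rfl⟩, rfl⟩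
    exact ⟨A, l, a, B, hL, hj, hB, rfl⟩
  · rintro ⟨A, l, a, B, hL, hj, hB, rfl⟩
    exact ⟨a, ⟨_, ⟨A, B, hL, hj, hB⟩, l, rfl⟩, rfl⟩

/-- The number of admissible nonzero indices for the operators `rho'`. -/
def rhoLabel' (π : Equiv.Perm (Fin n)) : ℕ := (dominatingCycles (cycleForm π)).length

theorem isSome_rho'_iff (i : ℕ) (π : Equiv.Perm (Fin n)) :
    (rho' i π).isSome ↔ i ≤ rhoLabel' π := by
  rcases i with _ | j
  · simp [rho']
  · rw [rhoLabel', Nat.succ_le_iff, ← List.length_reverse]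
    constructor
    · intro h
      rw [rho', Option.isSome_map, Option.isSome_iff_exists] at h
      obtain ⟨a, h⟩ := h
      obtain ⟨d, hd, -⟩ := Option.bind_eq_some_iff.1 h
      exact (List.getElem?_eq_some_iff.1 hd).1
    · intro h
      obtain ⟨A, B, hL, hj, hB⟩ :=
        reverse_dominatingCycles_getElem?.1 (List.getElem?_eq_getElem h)
      generalize (dominatingCycles (cycleForm π)).reverse[j] = d at hL hB
      obtain ⟨l, a, rfl⟩ := List.eq_nil_or_concat' d |>.resolve_left
        ((isForm_cycleForm π).ne_nil (by simp [hL]))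
      rw [rho'_succ_eq_some_iff.2 ⟨A, l, a, B, hL, hj, hB, rfl⟩]
      rfl

theorem rhoLabel'_addFixed (π : Equiv.Perm (Fin n)) :
    rhoLabel' (addFixed π) = rhoLabel' π + 1 := by
  rw [rhoLabel', rhoLabel', cycleForm_addFixed, dominatingCycles_cons_pos,
    dominatingCycles_map Fin.strictMono_castSucc]
  · simp
  · intro y hy x hx
    obtain rfl := List.mem_singleton.1 hy
    rw [← List.map_flatten, List.mem_map] at hx
    obtain ⟨z, -, rfl⟩ := hx
    exact Fin.castSucc_lt_last z

/-- The new letter ends domination for all cycles to its left, while its own cycle and those to the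
right keep their status. The label therefore recovers the index, which also gives injectivity. -/
theorem rhoLabel'_of_rho' {π : Equiv.Perm (Fin n)} {τ : Equiv.Perm (Fin (n + 1))} {j : ℕ}
    (h : rho' (j + 1) π = some τ) : rhoLabel' τ = j + 1 := by
  obtain ⟨A, l, a, B, hL, rfl, hB, rfl⟩ := rho'_succ_eq_some_iff.1 h
  have hF := isForm_cycleForm π
  rw [hL] at hF
  obtain ⟨h1, h2, -, h3⟩ := hF.disjoint_of_append
  rw [rhoLabel', cycleForm_insertAfter, hL, List.map_append, map_insertLetter_of_notMem h1,
    List.map_cons, map_insertLetter_of_notMem h3, insertLetter_append_cons h2 (by simp),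
    dominatingCycles_append, dominatingCycles_cons_pos,
    dominatingCycles_map Fin.strictMono_castSucc]
  · simp
  · intro y hy x hx
    rw [← List.map_flatten, List.mem_map] at hx
    obtain ⟨x, hx, rfl⟩ := hx
    rcases List.mem_append.1 hy with hy | hy
    · obtain ⟨t, ht, rfl⟩ := List.mem_map.1 hy
      exact Fin.castSucc_lt_castSucc_iff.2 (hB t ht x hx)
    · simp only [List.map_nil, List.mem_singleton] at hy
      subst hy
      exact Fin.castSucc_lt_last x
  · intro c hc
    obtain ⟨d, hd, rfl⟩ := List.mem_map.1 hc
    obtain ⟨m, t, rfl, -⟩ := hF.cyc d (by simp [hd])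
    exact ⟨m.castSucc, by simp, Fin.last n, by simp, Fin.le_last _⟩

theorem isCatalanTree_rho' : IsCatalanTree (X := fun n => Equiv.Perm (Fin n)) rhoSeq'
    (fun _ => rho') (fun _ => rhoLabel') (fun _ => numCycles)
    (fun _ π => CyclicallyAvoids ![1, 3, 2] π) where
  root := ⟨1, fun _ => rfl, by
      simp [CyclicallyAvoids, occurs_132_iff, cycleForm, cycleMinima, Has132],
    by simp [rhoLabel', cycleForm, cycleMinima, dominatingCycles],
    by simp [numCycles, cycleForm, cycleMinima],
    fun y _ => Subsingleton.elim _ _⟩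
  seq_succ n s := rfl
  isSome_op n i π _ := isSome_rho'_iff i π
  good_op n i π τ hπ h := by
    rcases i with _ | j
    · cases h
      exact cyclicallyAvoids_132_addFixed.2 hπ
    · obtain ⟨A, l, a, B, hL, -, hB, rfl⟩ := rho'_succ_eq_some_iff.1 h
      refine (cyclicallyAvoids_132_insertAfter (u := A.flatten ++ l) (v := B.flatten)
        (by simp [hL])).2 ⟨hπ, ?_⟩
      have hF := isForm_cycleForm π
      rw [hL] at hF
      intro x hx z hz
      rw [List.append_assoc, List.mem_append] at hx
      rcases hx with hx | hx
      · obtain ⟨c, hc, hxc⟩ := List.mem_flatten.1 hx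
        obtain ⟨y, hy, hlt⟩ := (List.pairwise_append.1 hF.desc).2.2 c hc (l ++ [a])
          (by simp)
        -- A letter of an earlier cycle exceeds some `y` in the chosen cycle, and `y` exceeds all
        -- that follows that cycle.
        exact ((hB y hy z hz).trans (hlt x hxc)).le
      · exact (hB x hx z hz).le
  lab_op n i π τ _ h := by
    rcases i with _ | j
    · cases h
      exact rhoLabel'_addFixed π
    · exact rhoLabel'_of_rho' h
  st_op n i π τ _ h := by
    rcases i with _ | j
    · cases h
      exact numCycles_addFixed π
    · obtain ⟨A, l, a, B, hL, -, -, rfl⟩ := rho'_succ_eq_some_iff.1 h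
      exact numCycles_insertAfter π a
  exists_op n τ hτ := by
    rcases eq_addFixed_or_insertAfter τ with ⟨π, rfl⟩ | ⟨π, a, rfl⟩
    · exact ⟨0, π, cyclicallyAvoids_132_addFixed.1 hτ, rfl⟩
    · have hF := isForm_cycleForm π
      obtain ⟨c, hc, hac⟩ := List.mem_flatten.1 (hF.mem a)
      obtain ⟨A, B, hL⟩ := List.append_of_mem hc
      obtain ⟨m, l, rfl, hm, -⟩ := hF.cyc c hc
      obtain ⟨u, v, huv⟩ := List.append_of_mem hac
      rw [cyclicallyAvoids_132_insertAfter (u := A.flatten ++ u) (v := v ++ B.flatten)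
        (by simp [hL, huv])] at hτ
      obtain ⟨hπ, hp⟩ := hτ
      -- A letter `z` after `a` in the same cycle would exceed the minimum `m`, which stands at or
      -- before `a`.
      have hv : v = [] := by
        rcases v with _ | ⟨z, v⟩
        · rfl
        · exfalso
          have hz : z ∈ l := by
            rcases u with _ | ⟨y, u⟩ <;> obtain ⟨rfl, rfl⟩ := List.cons.inj huv <;> simp
          have hm' : m ∈ u ++ [a] := by
            rcases u with _ | ⟨y, u⟩ <;> obtain ⟨rfl, rfl⟩ := List.cons.inj huv <;> simp
          have := hp m (by rw [List.append_assoc]; exact List.mem_append_right _ hm') z (by simp)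
          exact (hm z hz).not_ge this
      subst hv
      rw [huv] at hL
      refine ⟨(dominatingCycles B).length + 1, π, hπ,
        rho'_succ_eq_some_iff.2 ⟨A, u, a, B, hL, rfl, ?_, rfl⟩⟩
      intro y hy x hx
      refine lt_of_le_of_ne (hp y (by rw [List.append_assoc]; exact List.mem_append_right _ hy) x
        (by simpa using hx)) ?_
      rintro rfl
      have hnd := hF.nodup
      rw [hL, List.flatten_append, List.flatten_cons, List.nodup_append, List.nodup_append] at hnd
      exact hnd.2.1.2.2 x hy x hx rfl
  op_inj n i j π σ τ _ _ hi hj := by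
    rcases i with _ | i <;> rcases j with _ | j
    · cases hi
      exact ⟨rfl, addFixed_injective (Option.some.inj hj).symm⟩
    · obtain ⟨A, l, a, B, -, -, -, rfl⟩ := rho'_succ_eq_some_iff.1 hj
      exact absurd (Option.some.inj hi) (addFixed_ne_insertAfter _ _ _)
    · obtain ⟨A, l, a, B, -, -, -, rfl⟩ := rho'_succ_eq_some_iff.1 hi
      exact absurd (Option.some.inj hj) (addFixed_ne_insertAfter _ _ _)
    · refine ⟨(rhoLabel'_of_rho' hi).symm.trans (rhoLabel'_of_rho' hj), ?_⟩
      obtain ⟨A, l, a, B, -, -, -, rfl⟩ := rho'_succ_eq_some_iff.1 hi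
      obtain ⟨A', l', a', B', -, -, -, he⟩ := rho'_succ_eq_some_iff.1 hj
      exact (insertAfter_inj he).1

end Operators

/-! ### Erasing the parentheses. -/

section FundamentalBijection

variable {n : ℕ}

/-- The place of the largest letter tells how it was added: in front for a fixed point, otherwise
right after `a`. Deleting it leaves the word of the smaller permutation, so induction applies. -/
theorem flatten_cycleForm_injective :
    ∀ {n : ℕ}, Function.Injective fun π : Equiv.Perm (Fin n) => (cycleForm π).flatten := by
  intro n
  induction n with
  | zero => exact fun _ _ _ => Subsingleton.elim _ _
  | succ n ih =>
    have hsplit : ∀ (π σ : Equiv.Perm (Fin n)) {U V U' V' : List (Fin n)},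
        (cycleForm π).flatten = U ++ V → (cycleForm σ).flatten = U' ++ V' →
        U.map Fin.castSucc ++ Fin.last n :: V.map Fin.castSucc =
          U'.map Fin.castSucc ++ Fin.last n :: V'.map Fin.castSucc →
        U = U' ∧ π = σ := by
      intro π σ U V U' V' h1 h2 h
      have hlast : ∀ w : List (Fin n), Fin.last n ∉ w.map Fin.castSucc := by simp
      have h3 := List.append_cons_inj_of_notMem (hlast U) (hlast V) |>.1 h
      have hinj := List.map_injective_iff.2 (Fin.castSucc_injective n)
      have hU := hinj h3.1
      have hV := hinj h3.2.2
      exact ⟨hU, ih (h1.trans (by rw [hU, hV, ← h2]))⟩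
    have hmem : ∀ (π : Equiv.Perm (Fin n)) a, ∃ u v, (cycleForm π).flatten = u ++ a :: v :=
      fun π a => List.append_of_mem ((isForm_cycleForm π).mem a)
    intro τ τ' h
    dsimp only at h
    rcases eq_addFixed_or_insertAfter τ with ⟨π, rfl⟩ | ⟨π, a, rfl⟩ <;>
      rcases eq_addFixed_or_insertAfter τ' with ⟨σ, rfl⟩ | ⟨σ, b, rfl⟩
    · rw [flatten_cycleForm_addFixed, flatten_cycleForm_addFixed] at h
      rw [(hsplit π σ (U := []) (U' := []) rfl rfl h).2]
    · obtain ⟨u, v, hw⟩ := hmem σ b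
      rw [flatten_cycleForm_addFixed, flatten_cycleForm_insertAfter σ hw] at h
      have := (hsplit π σ (U := []) (U' := u ++ [b]) rfl (by simp [hw]) h).1
      simp at this
    · obtain ⟨u, v, hw⟩ := hmem π a
      rw [flatten_cycleForm_addFixed, flatten_cycleForm_insertAfter π hw] at h
      have := (hsplit π σ (U := u ++ [a]) (U' := []) (by simp [hw]) rfl h).1
      simp at this
    · obtain ⟨u, v, hw⟩ := hmem π a
      obtain ⟨u', v', hw'⟩ := hmem σ b
      rw [flatten_cycleForm_insertAfter π hw, flatten_cycleForm_insertAfter σ hw'] at h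
      have := hsplit π σ (U := u ++ [a]) (U' := u' ++ [b]) (by simp [hw]) (by simp [hw']) h
      obtain ⟨h1, rfl⟩ := this
      obtain ⟨-, h2⟩ := List.append_inj' h1 rfl
      rw [List.singleton_inj.1 h2]

theorem length_flatten_cycleForm (π : Equiv.Perm (Fin n)) : (cycleForm π).flatten.length = n := by
  have hF := isForm_cycleForm π
  rw [← List.toFinset_card_of_nodup hF.nodup, Finset.eq_univ_of_forall (fun x =>
    List.mem_toFinset.2 (hF.mem x)), Finset.card_univ, Fintype.card_fin]

/-- Removing the parentheses from the standard cycle form is a bijection from permutations to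
permutations in one-line form. -/
theorem exists_equiv_ofFn_eq_flatten_cycleForm (n : ℕ) :
    ∃ e : Equiv.Perm (Fin n) ≃ Equiv.Perm (Fin n),
      ∀ π, List.ofFn (e π) = (cycleForm π).flatten := by
  have hex : ∀ π : Equiv.Perm (Fin n), ∃ σ : Equiv.Perm (Fin n),
      List.ofFn σ = (cycleForm π).flatten := by
    intro π
    have hlen := length_flatten_cycleForm π
    have hnd := (isForm_cycleForm π).nodup
    have hinj : Function.Injective fun i : Fin n => (cycleForm π).flatten.get (i.cast hlen.symm) :=
      fun i j h => by
        have := hnd.injective_get h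
        simpa using this
    refine ⟨Equiv.ofBijective _ (Finite.injective_iff_bijective.1 hinj), ?_⟩
    refine List.ext_get (by simp [hlen]) fun i h1 h2 => ?_
    simp
  choose f hf using hex
  have hinj : Function.Injective f := fun π σ h =>
    flatten_cycleForm_injective (by dsimp only; rw [← hf, ← hf, h])
  exact ⟨Equiv.ofBijective f (Finite.injective_iff_bijective.1 hinj), hf⟩

end FundamentalBijection

/-! ### Descents and cycles of 1–3–2 avoiders. -/

section Descents

variable {α : Type*} [LinearOrder α]

theorem descents_cons_cons (x y : α) (w : List α) :
    descents (x :: y :: w) = descents (y :: w) + if y < x then 1 else 0 := by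
  simp [descents, List.countP_cons]

/-- The step from `a` to `M` is an ascent, and a descent from `a` into `v` is replaced by one from
`M` into `v`. -/
theorem descents_append_insert {a M : α} {v : List α} (ha : a < M) (hM : ∀ z ∈ v, z < M)
    (hv : ∀ z ∈ v, z < a) (u : List α) :
    descents (u ++ a :: M :: v) = descents (u ++ a :: v) := by
  induction u with
  | nil =>
    rw [List.nil_append, List.nil_append, descents_cons_cons, if_neg ha.not_gt]
    rcases v with _ | ⟨z, v⟩
    · rfl
    · rw [descents_cons_cons, descents_cons_cons, if_pos (hM z (by simp)),
        if_pos (hv z (by simp))]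
  | cons x u ih =>
    rcases u with _ | ⟨y, u⟩
    · simp only [List.cons_append, List.nil_append] at ih ⊢
      rw [descents_cons_cons, ih, ← descents_cons_cons]
    · simp only [List.cons_append] at ih ⊢
      rw [descents_cons_cons, ih, ← descents_cons_cons]

theorem descents_map {β : Type*} [LinearOrder β] {f : α → β} (hf : StrictMono f) :
    ∀ w : List α, descents (w.map f) = descents w
  | [] => rfl
  | [x] => rfl
  | x :: y :: w => by
    have := descents_map hf (y :: w)
    rw [List.map_cons] at this
    rw [List.map_cons, List.map_cons, descents_cons_cons, descents_cons_cons, this]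
    simp only [hf.lt_iff_lt]

/-- A new fixed point puts the maximum in front, adding one cycle and one descent; an admissible
insertion changes neither number. The empty permutation is excluded since it has no cycles. -/
theorem descents_add_one_eq_numCycles : ∀ {n : ℕ} (π : Equiv.Perm (Fin (n + 1))),
    CyclicallyAvoids ![1, 3, 2] π → descents (cycleForm π).flatten + 1 = numCycles π := by
  intro n
  induction n with
  | zero =>
    intro π _
    obtain rfl : π = addFixed 1 := Equiv.ext fun x => Fin.ext (by omega)
    rw [numCycles_addFixed, flatten_cycleForm_addFixed]
    simp [numCycles, cycleForm, cycleMinima, descents]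
  | succ n ih =>
    intro τ hτ
    rcases eq_addFixed_or_insertAfter τ with ⟨π, rfl⟩ | ⟨π, a, rfl⟩
    · rw [numCycles_addFixed, flatten_cycleForm_addFixed,
        ← ih π (cyclicallyAvoids_132_addFixed.1 hτ)]
      obtain ⟨x, w, hw⟩ := List.exists_cons_of_length_pos
        (show 0 < (cycleForm π).flatten.length by rw [length_flatten_cycleForm]; omega)
      rw [hw, List.map_cons, descents_cons_cons, if_pos (Fin.castSucc_lt_last x), ← List.map_cons,
        descents_map Fin.strictMono_castSucc]
    · have hF := isForm_cycleForm π
      obtain ⟨u, v, hw⟩ := List.append_of_mem (hF.mem a)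
      obtain ⟨hπ, hp⟩ := (cyclicallyAvoids_132_insertAfter hw).1 hτ
      rw [numCycles_insertAfter, ← ih π hπ, flatten_cycleForm_insertAfter π hw, hw,
        ← descents_map Fin.strictMono_castSucc (u ++ a :: v)]
      have hlast : ∀ z ∈ v.map Fin.castSucc, z < Fin.last (n + 1) := by
        intro z hz
        obtain ⟨z, -, rfl⟩ := List.mem_map.1 hz
        exact Fin.castSucc_lt_last z
      have hlt : ∀ z ∈ v.map Fin.castSucc, z < a.castSucc := by
        intro z hz
        obtain ⟨t, ht, rfl⟩ := List.mem_map.1 hz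
        rw [Fin.castSucc_lt_castSucc_iff]
        refine lt_of_le_of_ne (hp a (by simp) t ht) ?_
        rintro rfl
        have hnd := hF.nodup
        rw [hw, List.nodup_append, List.nodup_cons] at hnd
        exact hnd.2.1.1 ht
      have := descents_append_insert (Fin.castSucc_lt_last a) hlast hlt (u.map Fin.castSucc)
      simp only [List.map_append, List.map_cons, List.map_nil, List.append_assoc,
        List.singleton_append, this]

/-- Permutations with `k` cycles cyclically avoiding `132` are equinumerous with permutations
with `k - 1` descents avoiding `132` in one-line form. -/
theorem card_cycAv_132_eq_card_avDes {n k : ℕ} (hn : 1 ≤ n) (hk : 1 ≤ k) :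
    Nat.card (CycAv ![1, 3, 2] n k) = Nat.card (AvDes ![1, 3, 2] n (k - 1)) := by
  obtain ⟨e, he⟩ := exists_equiv_ofFn_eq_flatten_cycleForm n
  refine Nat.card_congr (e.subtypeEquiv fun π => ?_)
  rw [he, CyclicallyAvoids]
  refine and_congr_right fun hπ => ?_
  obtain ⟨m, rfl⟩ : ∃ m, n = m + 1 := ⟨n - 1, by omega⟩
  have := descents_add_one_eq_numCycles π hπ
  omega

end Descents

/-! ### Excursions, peaks and the operators on Dyck paths. -/

section DyckOperators

open DyckStep

theorem excursions_zero : excursions 0 = [] := by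
  rw [excursions, dif_pos rfl]

theorem excursions_of_ne_zero {p : DyckWord} (h : p ≠ 0) :
    excursions p = p.insidePart.nest :: excursions p.outsidePart := by
  rw [excursions, dif_neg h]

theorem nest_add_ne_zero (p q : DyckWord) : p.nest + q ≠ 0 := fun h => by
  have := congrArg DyckWord.semilength h
  simp at this

theorem excursions_nest_add (p q : DyckWord) :
    excursions (p.nest + q) = p.nest :: excursions q := by
  rw [excursions_of_ne_zero (nest_add_ne_zero p q),
    DyckWord.insidePart_add DyckWord.nest_ne_zero, DyckWord.outsidePart_add DyckWord.nest_ne_zero,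
    DyckWord.insidePart_nest, DyckWord.outsidePart_nest, zero_add]

theorem excursions_nest (p : DyckWord) : excursions p.nest = [p.nest] := by
  rw [← add_zero p.nest, excursions_nest_add, excursions_zero, add_zero]

/-- Normal form: in it `excursions` reads off the summands, so the later list identities become
immediate. -/
theorem exists_eq_sum_map_nest (p : DyckWord) : ∃ l : List DyckWord, p = (l.map .nest).sum := by
  induction p using excursions.induct with
  | case1 => exact ⟨[], rfl⟩
  | case2 p h ih =>
    obtain ⟨l, hl⟩ := ih
    exact ⟨p.insidePart :: l, by
      rw [List.map_cons, List.sum_cons, ← hl, DyckWord.nest_insidePart_add_outsidePart h]⟩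

theorem excursions_sum_map_nest (l : List DyckWord) :
    excursions (l.map .nest).sum = l.map .nest := by
  induction l with
  | nil => exact excursions_zero
  | cons p l ih => rw [List.map_cons, List.sum_cons, excursions_nest_add, ih]

theorem sum_excursions (p : DyckWord) : (excursions p).sum = p := by
  obtain ⟨l, rfl⟩ := exists_eq_sum_map_nest p
  rw [excursions_sum_map_nest]

theorem excursions_add (p q : DyckWord) : excursions (p + q) = excursions p ++ excursions q := by
  obtain ⟨l, rfl⟩ := exists_eq_sum_map_nest p
  obtain ⟨m, rfl⟩ := exists_eq_sum_map_nest q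
  rw [← List.sum_append, ← List.map_append, excursions_sum_map_nest, excursions_sum_map_nest,
    excursions_sum_map_nest, List.map_append]

theorem excursions_sum_take (p : DyckWord) (j : ℕ) :
    excursions ((excursions p).take j).sum = (excursions p).take j := by
  obtain ⟨l, rfl⟩ := exists_eq_sum_map_nest p
  rw [excursions_sum_map_nest, ← List.map_take, excursions_sum_map_nest]

/-- The lifted part of an `r (j + 1)` step is nonempty. So no peak is created, and the result is
never one of `r 0`. -/
theorem sum_drop_excursions_ne_zero {p : DyckWord} {j : ℕ} (h : j < (excursions p).length) :
    ((excursions p).drop j).sum ≠ 0 := by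
  obtain ⟨l, rfl⟩ := exists_eq_sum_map_nest p
  rw [excursions_sum_map_nest, List.length_map] at h
  rw [excursions_sum_map_nest, List.drop_eq_getElem_cons (by simpa using h), List.sum_cons,
    List.getElem_map]
  exact nest_add_ne_zero _ _

theorem excursions_eq_nil {p : DyckWord} : excursions p = [] ↔ p = 0 :=
  ⟨fun h => by rw [← sum_excursions p, h, List.sum_nil], fun h => h ▸ excursions_zero⟩

theorem nest_injective : Function.Injective DyckWord.nest := fun p q h => by
  rw [← DyckWord.insidePart_nest (p := p), h, DyckWord.insidePart_nest]

/-- The number of occurrences of `U` immediately followed by `D`. -/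
def wordPeaks (w : List DyckStep) : ℕ := (w.zip w.tail).count (U, D)

theorem wordPeaks_cons_cons (x y : DyckStep) (w : List DyckStep) :
    wordPeaks (x :: y :: w) = wordPeaks (y :: w) + if (x, y) = (U, D) then 1 else 0 := by
  simp [wordPeaks, List.count_cons]

theorem wordPeaks_D_cons (w : List DyckStep) : wordPeaks (D :: w) = wordPeaks w := by
  cases w with
  | nil => rfl
  | cons x w => simp [wordPeaks_cons_cons]

/-- No peak starts at a down step, so cutting right after one loses none. -/
theorem wordPeaks_append (v w : List DyckStep) :
    wordPeaks (v ++ D :: w) = wordPeaks (v ++ [D]) + wordPeaks w := by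
  induction v with
  | nil =>
    rw [List.nil_append, wordPeaks_D_cons]
    exact (Nat.zero_add _).symm
  | cons x v ih =>
    rcases v with _ | ⟨y, v⟩
    · simp only [List.cons_append, List.nil_append] at ih ⊢
      rw [wordPeaks_cons_cons, ih, wordPeaks_cons_cons]
      omega
    · simp only [List.cons_append] at ih ⊢
      rw [wordPeaks_cons_cons, ih, wordPeaks_cons_cons]
      omega

theorem exists_toList_eq_append_D {p : DyckWord} (h : p ≠ 0) : ∃ v, p.toList = v ++ [D] := by
  have h' := DyckWord.toList_ne_nil.2 h
  exact ⟨p.toList.dropLast, by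
    rw [← DyckWord.getLast_eq_D p h', List.dropLast_append_getLast]⟩

theorem exists_toList_eq_U_cons {p : DyckWord} (h : p ≠ 0) : ∃ v, p.toList = U :: v := by
  have h' := DyckWord.toList_ne_nil.2 h
  exact ⟨p.toList.tail, by rw [← DyckWord.head_eq_U p h', List.cons_head_tail]⟩

theorem peaks_zero : peaks 0 = 0 := rfl

theorem peaks_add (p q : DyckWord) : peaks (p + q) = peaks p + peaks q := by
  by_cases h : p = 0
  · rw [h, zero_add, peaks_zero, zero_add]
  · obtain ⟨v, hv⟩ := exists_toList_eq_append_D h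
    change wordPeaks (p.toList ++ q.toList) = wordPeaks p.toList + wordPeaks q.toList
    rw [hv, List.append_assoc, List.singleton_append, wordPeaks_append]

theorem peaks_nest_zero : peaks (DyckWord.nest 0) = 1 := rfl

/-- A nonempty path starts with `U` and ends with `D`, so the two outer steps complete no peak. -/
theorem peaks_nest {p : DyckWord} (h : p ≠ 0) : peaks p.nest = peaks p := by
  obtain ⟨v, hv⟩ := exists_toList_eq_append_D h
  obtain ⟨w, hw⟩ := exists_toList_eq_U_cons h
  change wordPeaks (U :: (p.toList ++ [D])) = wordPeaks p.toList
  rw [hw, List.cons_append, wordPeaks_cons_cons,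
    ← List.cons_append, ← hw, hv, List.append_assoc, List.singleton_append, wordPeaks_append]
  simp [wordPeaks]

theorem r_succ_eq_some_iff {p q : DyckWord} {j : ℕ} : r (j + 1) p = some q ↔
    j < (excursions p).length ∧
      q = ((excursions p).take j).sum + ((excursions p).drop j).sum.nest := by
  rw [r]
  split_ifs with h
  · simp [h, eq_comm]
  · simp [h]

theorem excursions_of_r_succ {p q : DyckWord} {j : ℕ} (h : r (j + 1) p = some q) :
    excursions q = (excursions p).take j ++ [((excursions p).drop j).sum.nest] := by
  obtain ⟨-, rfl⟩ := r_succ_eq_some_iff.1 h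
  rw [excursions_add, excursions_sum_take, excursions_nest]

theorem sum_take_add_sum_drop (p : DyckWord) (j : ℕ) :
    ((excursions p).take j).sum + ((excursions p).drop j).sum = p := by
  rw [← List.sum_append, List.take_append_drop, sum_excursions]

theorem isCatalanTree_r : IsCatalanTree (X := fun _ => DyckWord) rSeq
    (fun _ => r) (fun _ p => (excursions p).length) (fun _ => peaks)
    (fun n p => p.semilength = n) where
  root := by
    refine ⟨0, fun _ => rfl, rfl, by rw [excursions_zero]; rfl, rfl, fun p hp => ?_⟩
    by_contra h
    have := DyckWord.semilength_insidePart_lt h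
    omega
  seq_succ n s := rfl
  isSome_op n i p _ := by
    rcases i with _ | j
    · simp [r]
    · rw [r]
      split_ifs with h
      · simpa using h
      · simp only [Option.isSome_none, Bool.false_eq_true, false_iff]
        omega
  good_op n i p q hp h := by
    rcases i with _ | j
    · cases h
      simp [hp]
    · obtain ⟨-, rfl⟩ := r_succ_eq_some_iff.1 h
      rw [DyckWord.semilength_add, DyckWord.semilength_nest, ← add_assoc,
        ← DyckWord.semilength_add, sum_take_add_sum_drop, hp]
  lab_op n i p q _ h := by
    rcases i with _ | j
    · cases h
      simp [excursions_add, excursions_nest]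
    · have hj := (r_succ_eq_some_iff.1 h).1
      rw [excursions_of_r_succ h, if_neg (by omega), List.length_append, List.length_take,
        min_eq_left hj.le]
      rfl
  st_op n i p q _ h := by
    rcases i with _ | j
    · cases h
      rw [peaks_add, peaks_nest_zero, if_pos rfl]
    · obtain ⟨hj, rfl⟩ := r_succ_eq_some_iff.1 h
      rw [peaks_add, peaks_nest (sum_drop_excursions_ne_zero hj), ← peaks_add,
        sum_take_add_sum_drop, if_neg (by omega)]
  exists_op n p hp := by
    obtain ⟨l, rfl⟩ := exists_eq_sum_map_nest p
    rcases List.eq_nil_or_concat' l with rfl | ⟨m, q, rfl⟩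
    · simp at hp
    rw [List.map_append, List.sum_append, List.map_singleton, List.sum_singleton] at hp ⊢
    -- The last excursion is `q.nest`: an isolated peak comes from `r 0`, and otherwise its outer
    -- steps are removed, the index being one more than the number of earlier excursions.
    by_cases hq : q = 0
    · subst hq
      exact ⟨0, (m.map .nest).sum, by simpa using hp, rfl⟩
    · refine ⟨(m.map DyckWord.nest).length + 1, (m.map .nest).sum + q, ?_, ?_⟩
      · rw [DyckWord.semilength_add] at hp ⊢
        rw [DyckWord.semilength_nest] at hp
        omega
      · have hE : excursions ((m.map .nest).sum + q) = m.map .nest ++ excursions q := by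
          rw [excursions_add, excursions_sum_map_nest]
        rw [r_succ_eq_some_iff, hE, List.take_left, List.drop_left, sum_excursions]
        refine ⟨?_, rfl⟩
        rw [List.length_append]
        have := List.length_pos_iff.2 (excursions_eq_nil.not.2 hq)
        omega
  op_inj n i j p p' q _ _ hi hj := by
    have hr0 : ∀ {p : DyckWord}, r 0 p = some q → excursions q = excursions p ++ [.nest 0] := by
      intro p h
      cases h
      rw [excursions_add, excursions_nest]
    have hne : ∀ {p p' j}, r 0 p = some q → r (j + 1) p' ≠ some q := by
      intro p p' j h h'
      have h1 := (hr0 h).symm.trans (excursions_of_r_succ h')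
      have h2 := (List.append_inj' h1 rfl).2
      exact sum_drop_excursions_ne_zero (r_succ_eq_some_iff.1 h').1
        (nest_injective (List.singleton_inj.1 h2)).symm
    rcases i with _ | i <;> rcases j with _ | j
    · have h1 := (List.append_inj' ((hr0 hi).symm.trans (hr0 hj)) rfl).1
      exact ⟨rfl, by rw [← sum_excursions p, h1, sum_excursions]⟩
    · exact absurd hj (hne hi)
    · exact absurd hi (hne hj)
    · obtain ⟨h1, h2⟩ := List.append_inj'
        ((excursions_of_r_succ hi).symm.trans (excursions_of_r_succ hj)) rfl
      have h3 := nest_injective (List.singleton_inj.1 h2)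
      have h4 := congrArg List.length h1
      rw [List.length_take, List.length_take, min_eq_left (r_succ_eq_some_iff.1 hi).1.le,
        min_eq_left (r_succ_eq_some_iff.1 hj).1.le] at h4
      exact ⟨congrArg _ h4, by
        rw [← sum_take_add_sum_drop p i, h1, h3, sum_take_add_sum_drop]⟩

end DyckOperators

end CyclicPattern

theorem mainTheorem5 :
    -- the operators generate exactly the Dyck paths and the pattern-avoiding permutations
    (∀ n : ℕ,
      (∀ p : DyckWord, (∃ s, CyclicPattern.rSeq n s = some p) ↔ p.semilength = n) ∧
      (∀ π : Equiv.Perm (Fin n),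
        (∃ s, CyclicPattern.rhoSeq n s = some π) ↔ CyclicPattern.CyclicallyAvoids ![1, 2, 3] π) ∧
      (∀ π : Equiv.Perm (Fin n),
        (∃ s, CyclicPattern.rhoSeq' n s = some π) ↔
          CyclicPattern.CyclicallyAvoids ![1, 3, 2] π)) ∧
    -- objects generated by the same sequence of indices correspond bijectively
    (∀ n k : ℕ,
      ∃ (Φ : CyclicPattern.DyckPeaks n k ≃ CyclicPattern.CycAv ![1, 2, 3] n k)
        (Φ' : CyclicPattern.DyckPeaks n k ≃ CyclicPattern.CycAv ![1, 3, 2] n k),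
        ∀ p : CyclicPattern.DyckPeaks n k,
          (∃! s : Fin n → ℕ, CyclicPattern.rSeq n s = some p.1) ∧
          ∀ s : Fin n → ℕ,
            (CyclicPattern.rhoSeq n s = some (Φ p).1 ↔ CyclicPattern.rSeq n s = some p.1) ∧
            (CyclicPattern.rhoSeq' n s = some (Φ' p).1 ↔ CyclicPattern.rSeq n s = some p.1)) ∧
    -- enumeration
    (∀ n k : ℕ, 1 ≤ n → 1 ≤ k →
      Nat.card (CyclicPattern.CycAv ![1, 3, 2] n k) = Nat.card (CyclicPattern.DyckPeaks n k) ∧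
      Nat.card (CyclicPattern.CycAv ![1, 3, 2] n k) =
        Nat.card (CyclicPattern.AvDes ![1, 3, 2] n (k - 1)) ∧
      Nat.card (CyclicPattern.CycAv ![1, 3, 2] n k) =
        Nat.card (CyclicPattern.CycAv ![1, 2, 3] n k) ∧
      (Nat.card (CyclicPattern.CycAv ![1, 3, 2] n k) : ℚ) =
        1 / (k : ℚ) * ((n - 1).choose (k - 1) : ℚ) * (n.choose (k - 1) : ℚ)) := by
  refine ⟨fun n => ⟨CyclicPattern.isCatalanTree_r.exists_seq_iff n,
    CyclicPattern.isCatalanTree_rho.exists_seq_iff n,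
    CyclicPattern.isCatalanTree_rho'.exists_seq_iff n⟩, fun n k => ?_, fun n k hn hk => ?_⟩
  · obtain ⟨e, he⟩ := CyclicPattern.isCatalanTree_r.exists_equiv n k
    obtain ⟨e₁, he₁⟩ := CyclicPattern.isCatalanTree_rho.exists_equiv n k
    obtain ⟨e₂, he₂⟩ := CyclicPattern.isCatalanTree_rho'.exists_equiv n k
    -- Both bijections pass through the common set of codes with `k` zeros, so they match objects
    -- with equal sequences.
    refine ⟨e.trans e₁.symm, e.trans e₂.symm, fun p =>
      ⟨CyclicPattern.isCatalanTree_r.existsUnique_seq n p.1 p.2.1, fun s => ⟨?_, ?_⟩⟩⟩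
    · rw [he₁, he, Equiv.trans_apply, Equiv.apply_symm_apply]
    · rw [he₂, he, Equiv.trans_apply, Equiv.apply_symm_apply]
  · obtain ⟨e, -⟩ := CyclicPattern.isCatalanTree_r.exists_equiv n k
    obtain ⟨e₁, -⟩ := CyclicPattern.isCatalanTree_rho.exists_equiv n k
    obtain ⟨e₂, -⟩ := CyclicPattern.isCatalanTree_rho'.exists_equiv n k
    refine ⟨Nat.card_congr (e₂.trans e.symm), CyclicPattern.card_cycAv_132_eq_card_avDes hn hk,
      Nat.card_congr (e₂.trans e₁.symm), ?_⟩
    rw [← CyclicPattern.card_code n k hn hk]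
    exact congrArg _ (Nat.card_congr e₂)
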